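/- A \emph{history} is a pair $(U,M)$ consisting of a strongly continuous one-parameter group $U=\{U_t:t\in\mathbb R\}$ of unitary operators on a separable infinite-dimensional complex Hilbert space $H$ and a type I subfactor $M\subseteq\mathcal B(H)$ which, with $\gamma_t(X)=U_tXU_t^*$, satisfies $\gamma_t(M)\subseteq M$ for $t\le 0$, $\big(\bigcup_{t\in\mathbb R}\gamma_t(M)\big)''=\mathcal B(H)$ and $\bigcap_{t\in\mathbb R}\gamma_t(M)=\mathbb C\mathbf 1$. An \emph{interaction} is a history together with normal states $\omega_-$ of $M$ and $\omega_+$ of the commutant $M'$ (the past and future states) such that $\omega_-(\gamma_{t}(X))=\omega_-(X)$ for $X\in M$, $t\le 0$, and $\omega_+(\gamma_t(X))=\omega_+(X)$ for $X\in M'$, $t\ge 0$. For $s\le t$ put $\mathcal A_{[s,t]}=\gamma_t(M)\cap\gamma_s(M)'$, and let $\mathcal A$ be the norm closure of the union of all the algebras $\mathcal A_{[s,t]}$. Let $\bar\omega_-$ (respectively $\bar\omega_+$) be the unique $\gamma$-invariant state of $\mathcal A$ that agrees with $\omega_-$ on $\mathcal A_I$ for every compact interval $I\subseteq(-\infty,0]$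 (respectively with $\omega_+$ on $\mathcal A_I$ for every compact interval $I\subseteq[0,\infty)$). The interaction is \emph{trivial} if $\bar\omega_-=\bar\omega_+$, and \emph{nontrivial} otherwise. The \emph{eigenvalue list} $\Lambda(\omega)=\{\lambda_1\ge\lambda_2\ge\cdots\}$ of a normal state $\omega$ of a type I factor $N\cong\mathcal B(K)$ is the decreasing sequence of the positive eigenvalues, counted with multiplicity and continued by zeros if there are only finitely many, of the positive trace class operator $R$ on $K$ for which $\omega(T)=\operatorname{trace}(RT)$, $T\in\mathcal B(K)$. \textbf{Corollary.} Let $(U,M)$ be an interaction with past and future states $\omega_-$, $\omega_+$. If $\Lambda(\omega_-)\ne\Lambda(\omega_+)$, then the interaction is nontrivial, i.e. $\bar\omega_-\ne\bar\omega_+$. -/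

import Mathlib

open scoped ComplexOrder InnerProductSpace

universe u

namespace Arveson

section States

variable {H : Type u} [NormedAddCommGroup H] [InnerProductSpace ℂ H] [CompleteSpace H]

/-- A state of a unital `*`-algebra `A` of bounded operators (in all uses below `A` is a
C*-algebra): a linear functional which is positive and takes the value `1` at the identity. -/
@[ext]
structure State (A : StarSubalgebra ℂ (H →L[ℂ] H)) extends A →ₗ[ℂ] ℂ where
  nonneg' : ∀ x : A, 0 ≤ toLinearMap (star x * x)
  map_one' : toLinearMap 1 = 1

/-- The value of a state at an operator of the algebra. -/
noncomputable def State.val {A : StarSubalgebra ℂ (H →L[ℂ] H)} (ω : State A) (X : H →L[ℂ] H) (hX : X ∈ A) : ℂ :=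
  ω.toLinearMap ⟨X, hX⟩

/-- A state of a von Neumann algebra `M` is normal if it preserves the suprema of upward directed
families of self-adjoint elements of `M` (in the operator order). -/
def State.IsNormal (M : VonNeumannAlgebra H) (ω : State M.toStarSubalgebra) : Prop :=
  ∀ S : Set M.toStarSubalgebra, S.Nonempty → (∀ x ∈ S, IsSelfAdjoint x) →
    DirectedOn (· ≤ ·) S → ∀ a : M.toStarSubalgebra, IsLUB S a →
      IsLUB ((fun x => (ω.toLinearMap x).re) '' S) (ω.toLinearMap a).re

/-- A von Neumann algebra is a type I factor if it is `*`-isomorphic to the algebra of all bounded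
operators on some Hilbert space. -/
def IsTypeIFactor (M : VonNeumannAlgebra H) : Prop :=
  ∃ (K : Type u) (_ : NormedAddCommGroup K) (_ : InnerProductSpace ℂ K) (_ : CompleteSpace K),
    Nonempty (M.toStarSubalgebra ≃⋆ₐ[ℂ] (K →L[ℂ] K))

/-- The operator `T` has trace `z`: the diagonal sums converge to `z` in every orthonormal basis. -/
def HasTrace (T : H →L[ℂ] H) (z : ℂ) : Prop :=
  ∀ (ι : Type u) (b : HilbertBasis ι ℂ H), HasSum (fun i => ⟪b i, T (b i)⟫_ℂ) z

/-- `Λ 0 ≥ Λ 1 ≥ ...` is the eigenvalue list of the positive trace class operator `R`: a decreasing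
summable sequence of nonnegative numbers in which every `μ > 0` occurs exactly as many times as its
multiplicity as an eigenvalue of `R`; the remaining terms, if any, are zero. -/
structure IsEigenvalueList (R : H →L[ℂ] H) (Λ : ℕ → ℝ) : Prop where
  antitone : Antitone Λ
  nonneg : ∀ n, 0 ≤ Λ n
  summable : Summable Λ
  multiplicity : ∀ μ : ℝ, 0 < μ →
    {n | Λ n = μ}.encard =
      Cardinal.toENat (Module.rank ℂ (Module.End.eigenspace (R : H →ₗ[ℂ] H) (μ : ℂ)))

/-- `Λ` is the eigenvalue list of the state `ω` of the type I factor `M`: under an identification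
of `M` with some `B(K)`, the state is `T ↦ trace (R T)` for a positive operator `R` on `K`, and `Λ`
is the eigenvalue list of `R`. -/
def State.HasEigenvalueList (M : VonNeumannAlgebra H) (ω : State M.toStarSubalgebra)
    (Λ : ℕ → ℝ) : Prop :=
  ∃ (K : Type u) (_ : NormedAddCommGroup K) (_ : InnerProductSpace ℂ K) (_ : CompleteSpace K)
    (θ : M.toStarSubalgebra ≃⋆ₐ[ℂ] (K →L[ℂ] K)) (R : K →L[ℂ] K),
    R.IsPositive ∧ (∀ x : M.toStarSubalgebra, HasTrace (R * θ x) (ω.toLinearMap x)) ∧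
      IsEigenvalueList R Λ

open Classical in
/-- The eigenvalue list `Λ(ω)` of a state. For a normal state of a type I factor the list exists
and is unique; in all other cases the value is irrelevant. -/
noncomputable def State.eigenvalueList (M : VonNeumannAlgebra H) (ω : State M.toStarSubalgebra) :
    ℕ → ℝ :=
  if h : ∃ Λ, State.HasEigenvalueList M ω Λ then h.choose else 0

theorem State.exists_bound {A : StarSubalgebra ℂ (H →L[ℂ] H)}
    (hA : IsClosed (A : Set (H →L[ℂ] H))) (ω : State A) :
    ∃ C : ℝ, 0 ≤ C ∧ ∀ x : A, ‖ω.toLinearMap x‖ ≤ C * ‖(x : H →L[ℂ] H)‖ := by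
  have := hA
  let _ : CStarAlgebra A := inferInstance
  let _ : PartialOrder A := CStarAlgebra.spectralOrder A
  have : StarOrderedRing A := CStarAlgebra.spectralOrderedRing A
  let f : A →ₚ[ℂ] ℂ := PositiveLinearMap.mk₀ ω.toLinearMap (by
    intro x hx
    obtain ⟨y, rfl⟩ := CStarAlgebra.nonneg_iff_eq_star_mul_self.mp hx
    exact ω.nonneg' y)
  obtain ⟨C, hC⟩ := f.exists_norm_apply_le
  exact ⟨C, C.2, hC⟩

/-- Abstract form of the extension of an invariant state of `N` to the C*-algebra generated by the
translates of `N`: `δ` moves every element of `A₀` into `N` after some time. -/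
theorem State.exists_extension {N A₀ : StarSubalgebra ℂ (H →L[ℂ] H)}
    (hN : IsClosed (N : Set (H →L[ℂ] H))) (ω : State N)
    (δ : ℝ → (H →L[ℂ] H) ≃⋆ₐ[ℂ] (H →L[ℂ] H)) (hδ : ∀ s t X, δ (s + t) X = δ s (δ t X))
    (hδn : ∀ t X, ‖δ t X‖ = ‖X‖)
    (hδN : ∀ t, 0 ≤ t → ∀ X ∈ N, δ t X ∈ N)
    (hω : ∀ t, 0 ≤ t → ∀ X (hX : X ∈ N) (hX' : δ t X ∈ N), ω.val (δ t X) hX' = ω.val X hX)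
    (hA : ∀ X ∈ A₀, ∃ t, δ t X ∈ N) (hδA : ∀ t, ∀ X ∈ A₀, δ t X ∈ A₀) :
    ∃ φ : State A₀.topologicalClosure,
      (∀ t X (hX : X ∈ A₀.topologicalClosure) (hX' : δ t X ∈ A₀.topologicalClosure),
        φ.val (δ t X) hX' = φ.val X hX) ∧
      ∀ X (hX : X ∈ A₀) (hX' : X ∈ N), φ.val X (A₀.le_topologicalClosure hX) = ω.val X hX' := by
  classical
  choose T hT using fun X : A₀ => hA X X.2
  have key : ∀ (X : H →L[ℂ] H) (a b : ℝ) (ha : δ a X ∈ N) (hb : δ b X ∈ N),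
      ω.val _ ha = ω.val _ hb := by
    have aux : ∀ (X : H →L[ℂ] H) (a b : ℝ) (ha : δ a X ∈ N) (hb : δ b X ∈ N), a ≤ b →
        ω.val _ ha = ω.val _ hb := by
      intro X a b ha hb hab
      have e : δ b X = δ (b - a) (δ a X) := by rw [← hδ, sub_add_cancel]
      have h1 := hω (b - a) (sub_nonneg.2 hab) _ ha (e ▸ hb)
      rw [← h1]
      simp only [e]
    intro X a b ha hb
    rcases le_total a b with h | h
    · exact aux X a b ha hb h
    · exact (aux X b a hb ha h).symm
  have late : ∀ (X : H →L[ℂ] H) (a b : ℝ), a ≤ b → δ a X ∈ N → δ b X ∈ N := by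
    intro X a b hab ha
    have e : δ b X = δ (b - a) (δ a X) := by rw [← hδ, sub_add_cancel]
    rw [e]
    exact hδN _ (sub_nonneg.2 hab) _ ha
  let p : A₀ → ℂ := fun X => ω.val (δ (T X) X) (hT X)
  have hp : ∀ (X : A₀) (t : ℝ) (h : δ t (X : H →L[ℂ] H) ∈ N), p X = ω.toLinearMap ⟨_, h⟩ :=
    fun X t h => key X _ _ _ _
  let ψ : A₀ →ₗ[ℂ] ℂ :=
    { toFun := p
      map_add' := by
        intro X Y
        have h1 := late X _ _ (le_max_left (T X) (T Y)) (hT X)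
        have h2 := late Y _ _ (le_max_right (T X) (T Y)) (hT Y)
        have h3 : δ (max (T X) (T Y)) ((X + Y : A₀) : H →L[ℂ] H) ∈ N := by
          simpa using add_mem h1 h2
        rw [hp X _ h1, hp Y _ h2, hp _ _ h3, ← map_add]
        congr 1
        ext1
        simp
      map_smul' := by
        intro c X
        have h3 : δ (T X) ((c • X : A₀) : H →L[ℂ] H) ∈ N := by
          simpa using SMulMemClass.smul_mem c (hT X)
        rw [hp X _ (hT X), hp _ _ h3, RingHom.id_apply, ← map_smul]
        congr 1
        ext1
        simp }
  obtain ⟨C, hC0, hC⟩ := ω.exists_bound hN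
  have hψC : ∀ X, ‖ψ X‖ ≤ C * ‖X‖ := fun X => by
    refine (hC ⟨_, hT X⟩).trans_eq ?_
    simp only [hδn]
    rfl
  obtain ⟨g, hg, -⟩ := exists_extension_norm_eq (𝕜 := ℂ) (Subalgebra.toSubmodule A₀.toSubalgebra)
    (LinearMap.mkContinuous (E := Subalgebra.toSubmodule A₀.toSubalgebra) ψ C hψC)
  have hg : ∀ X : A₀, g X = p X := fun X => hg X
  have cl : ∀ {P : (H →L[ℂ] H) → Prop}, IsClosed {X | P X} → (∀ X ∈ A₀, P X) →
      ∀ X ∈ A₀.topologicalClosure, P X := by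
    intro P hP h X hX
    exact closure_minimal (s := (A₀ : Set (H →L[ℂ] H))) h hP hX
  have hgδ : ∀ t, ∀ X ∈ A₀.topologicalClosure, g (δ t X) = g X := by
    intro t
    have hc : Continuous (δ t) := by
      have : Isometry (δ t) := AddMonoidHomClass.isometry_of_norm (δ t) (hδn t)
      exact this.continuous
    refine cl (isClosed_eq (g.continuous.comp hc) g.continuous) ?_
    intro X hX
    obtain ⟨s, hs⟩ := hA X hX
    have hs' : δ (s - t) (δ t X) ∈ N := by rwa [← hδ, sub_add_cancel]
    have h1 := hg ⟨X, hX⟩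
    have h2 := hg ⟨_, hδA t X hX⟩
    rw [hp _ s hs] at h1
    rw [hp _ (s - t) hs'] at h2
    simp only at h1 h2
    rw [h1, h2]
    congr 1
    ext1
    simp only [← hδ, sub_add_cancel]
  refine ⟨⟨(g : (H →L[ℂ] H) →ₗ[ℂ] ℂ).comp
    (Subalgebra.toSubmodule A₀.topologicalClosure.toSubalgebra).subtype, ?_, ?_⟩, ?_, ?_⟩
  · rintro ⟨X, hX⟩
    refine cl (P := fun X => 0 ≤ g (star X * X)) ?_ ?_ X hX
    · exact isClosed_le continuous_const (g.continuous.comp (continuous_star.mul continuous_id))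
    · intro X hX
      have h1 := hg ⟨star X * X, mul_mem (star_mem hX) hX⟩
      obtain ⟨s, hs⟩ := hA X hX
      have hst : δ s (star X) = star (δ s X) := (δ s).map_star' X
      have hs' : δ s (star X * X) ∈ N := by
        rw [map_mul, hst]; exact mul_mem (star_mem hs) hs
      rw [hp _ s hs'] at h1
      simp only at h1
      rw [h1]
      convert ω.nonneg' ⟨_, hs⟩ using 2
      ext1
      change δ s (star X * X) = star (δ s X) * δ s X
      rw [map_mul, hst]
  · have h1 := hg 1
    have hs : δ 0 ((1 : A₀) : H →L[ℂ] H) ∈ N := by simp [one_mem]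
    rw [hp _ 0 hs] at h1
    change g 1 = 1
    refine h1.trans ?_
    rw [← ω.map_one']
    congr 1
    ext1
    simp
  · intro t X hX hX'
    exact hgδ t X hX
  · intro X hX hX'
    have h0 : δ 0 X = X := by
      apply EquivLike.injective (δ 0)
      rw [← hδ, add_zero]
    have h1 := hg ⟨X, hX⟩
    rw [hp _ 0 (by simpa [h0] using hX')] at h1
    refine h1.trans ?_
    simp only [h0]
    rfl

/-- Two states of a closed algebra which agree on a dense subalgebra are equal. -/
theorem State.ext_closure {A₀ : StarSubalgebra ℂ (H →L[ℂ] H)} (φ ψ : State A₀.topologicalClosure)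
    (h : ∀ X (hX : X ∈ A₀), φ.val X (A₀.le_topologicalClosure hX) =
      ψ.val X (A₀.le_topologicalClosure hX)) : φ = ψ := by
  have hcont : ∀ φ : State A₀.topologicalClosure, Continuous φ.toLinearMap := by
    intro φ
    obtain ⟨C, -, hC⟩ := φ.exists_bound A₀.isClosed_topologicalClosure
    exact AddMonoidHomClass.continuous_of_bound φ.toLinearMap C hC
  have hd : DenseRange (StarSubalgebra.inclusion A₀.le_topologicalClosure) := by
    rintro ⟨X, hX⟩
    rw [Topology.IsInducing.subtypeVal.closure_eq_preimage_closure_image, ← Set.range_comp]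
    have : Set.range (Subtype.val ∘ StarSubalgebra.inclusion A₀.le_topologicalClosure) =
        (A₀ : Set (H →L[ℂ] H)) := by
      ext Y
      constructor
      · rintro ⟨Z, rfl⟩
        exact Z.2
      · intro hY
        exact ⟨⟨Y, hY⟩, rfl⟩
    exact this ▸ hX
  have := hd.equalizer (hcont φ) (hcont ψ) (funext fun X => h X X.2)
  ext x
  exact congrFun this x

end States

section Interactions

variable {H : Type u} [NormedAddCommGroup H] [InnerProductSpace ℂ H] [CompleteSpace H]

variable (H) in
/-- A history: a strongly continuous one-parameter group `U` of unitary operators on a separable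
infinite-dimensional Hilbert space, and a type I subfactor `M`, invariant under the automorphisms
`X ↦ U t X (U t)*` for negative `t`, whose translates generate `B(H)` as a von Neumann algebra and
intersect in the scalars. -/
structure History where
  separable : TopologicalSpace.SeparableSpace H
  infinite_dimensional : ¬ FiniteDimensional ℂ H
  U : ℝ → unitary (H →L[ℂ] H)
  U_add : ∀ s t, U (s + t) = U s * U t
  U_continuous : ∀ ξ : H, Continuous fun t => (U t : H →L[ℂ] H) ξ
  M : VonNeumannAlgebra H
  typeI : IsTypeIFactor M
  invariant : ∀ t ≤ 0, ∀ X ∈ M, Unitary.conjStarAlgAut ℂ (H →L[ℂ] H) (U t) X ∈ M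
  irreducible : Set.centralizer (Set.centralizer
    (⋃ t, Unitary.conjStarAlgAut ℂ (H →L[ℂ] H) (U t) '' (M : Set (H →L[ℂ] H)))) = Set.univ
  trivial_past : ⋂ t, Unitary.conjStarAlgAut ℂ (H →L[ℂ] H) (U t) '' (M : Set (H →L[ℂ] H)) =
    Set.range fun c : ℂ => c • (1 : H →L[ℂ] H)

namespace History

variable (h : History H)

/-- The automorphism group `γ_t(X) = U_t X U_t*`. -/
noncomputable def γ (t : ℝ) : (H →L[ℂ] H) ≃⋆ₐ[ℂ] (H →L[ℂ] H) :=
  Unitary.conjStarAlgAut ℂ (H →L[ℂ] H) (h.U t)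

/-- The algebra `A_[s,t] = γ_t(M) ∩ γ_s(M)'` of observables local in the interval `[s,t]`. -/
noncomputable def localAlg (s t : ℝ) : StarSubalgebra ℂ (H →L[ℂ] H) :=
  h.M.toStarSubalgebra.map (h.γ t).toStarAlgHom ⊓
    StarSubalgebra.centralizer ℂ (h.γ s '' (h.M : Set (H →L[ℂ] H)))

theorem γ_add (s t : ℝ) (X : H →L[ℂ] H) : h.γ (s + t) X = h.γ s (h.γ t X) := by
  simp only [γ, h.U_add, map_mul, StarAlgEquiv.mul_apply]

theorem γ_zero (X : H →L[ℂ] H) : h.γ 0 X = X := by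
  apply EquivLike.injective (h.γ 0)
  rw [← γ_add, add_zero]

theorem norm_γ (t : ℝ) (X : H →L[ℂ] H) : ‖h.γ t X‖ = ‖X‖ := by
  exact NonUnitalStarAlgHom.norm_map (h.γ t) (h.γ t).injective X

theorem γ_mem {t : ℝ} (ht : t ≤ 0) {X : H →L[ℂ] H} (hX : X ∈ h.M) : h.γ t X ∈ h.M :=
  h.invariant t ht X hX

theorem γ_mem_commutant {t : ℝ} (ht : 0 ≤ t) {X : H →L[ℂ] H} (hX : X ∈ h.M.commutant) :
    h.γ t X ∈ h.M.commutant := by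
  rw [VonNeumannAlgebra.mem_commutant_iff] at hX ⊢
  intro Y hY
  have h1 := hX _ (h.γ_mem (neg_nonpos.2 ht) hY)
  have h2 := congrArg (h.γ t) h1
  simpa only [map_mul, ← γ_add, add_neg_cancel, γ_zero] using h2

theorem mem_localAlg {s t : ℝ} {X : H →L[ℂ] H} :
    X ∈ h.localAlg s t ↔ h.γ (-t) X ∈ h.M ∧ h.γ (-s) X ∈ h.M.commutant := by
  have e1 : ∀ (a : ℝ) (Y : H →L[ℂ] H), h.γ a (h.γ (-a) Y) = Y := fun a Y => by
    rw [← γ_add, add_neg_cancel, γ_zero]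
  have e2 : ∀ (a : ℝ) (Y : H →L[ℂ] H), h.γ (-a) (h.γ a Y) = Y := fun a Y => by
    rw [← γ_add, neg_add_cancel, γ_zero]
  rw [localAlg, StarSubalgebra.mem_inf]
  refine and_congr ?_ ?_
  · constructor
    · rintro ⟨Y, hY, rfl⟩
      change h.γ (-t) (h.γ t Y) ∈ h.M
      rw [e2]
      exact hY
    · intro hX
      exact ⟨_, hX, e1 t X⟩
  · rw [StarSubalgebra.mem_centralizer_iff, VonNeumannAlgebra.mem_commutant_iff]
    constructor
    · intro hX Y hY
      have h2 := congrArg (h.γ (-s)) (hX _ ⟨Y, hY, rfl⟩).1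
      simpa only [map_mul, e2] using h2
    · rintro hX _ ⟨Y, hY, rfl⟩
      have h2 := congrArg (h.γ s) (hX _ hY)
      have h3 := congrArg (h.γ s) (hX _ (star_mem hY))
      have h4 : h.γ s (star Y) = star (h.γ s Y) := (h.γ s).map_star' Y
      rw [map_mul, map_mul, e1] at h2 h3
      rw [h4] at h3
      exact ⟨h2, h3⟩

theorem γ_mem_localAlg {s t : ℝ} {X : H →L[ℂ] H} (r : ℝ) (hX : X ∈ h.localAlg s t) :
    h.γ r X ∈ h.localAlg (s + r) (t + r) := by
  rw [mem_localAlg] at hX ⊢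
  rw [← γ_add, ← γ_add]
  convert hX using 3 <;> ring_nf

theorem localAlg_mono {s t s' t' : ℝ} (hs : s' ≤ s) (ht : t ≤ t') :
    h.localAlg s t ≤ h.localAlg s' t' := by
  intro X hX
  rw [mem_localAlg] at hX ⊢
  constructor
  · have := h.γ_mem (sub_nonpos.2 ht) hX.1
    rw [← γ_add] at this
    convert this using 2
    ring_nf
  · have := h.γ_mem_commutant (sub_nonneg.2 hs) hX.2
    rw [← γ_add] at this
    convert this using 2
    ring_nf

theorem localAlg_le_past {s t : ℝ} (ht : t ≤ 0) : h.localAlg s t ≤ h.M.toStarSubalgebra := by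
  intro X hX
  have := h.γ_mem ht (h.mem_localAlg.1 hX).1
  rwa [← γ_add, add_neg_cancel, γ_zero] at this

theorem localAlg_le_future {s t : ℝ} (hs : 0 ≤ s) :
    h.localAlg s t ≤ h.M.commutant.toStarSubalgebra := by
  intro X hX
  have := h.γ_mem_commutant hs (h.mem_localAlg.1 hX).2
  rwa [← γ_add, add_neg_cancel, γ_zero] at this

/-- The union of the local algebras over all compact intervals. -/
noncomputable def localUnion : StarSubalgebra ℂ (H →L[ℂ] H) where
  carrier := {X | ∃ s t : ℝ, s ≤ t ∧ X ∈ h.localAlg s t}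
  mul_mem' := by
    rintro X Y ⟨s, t, hst, hX⟩ ⟨s', t', -, hY⟩
    exact ⟨min s s', max t t', (min_le_left _ _).trans (hst.trans (le_max_left _ _)),
      mul_mem (h.localAlg_mono (min_le_left _ _) (le_max_left _ _) hX)
        (h.localAlg_mono (min_le_right _ _) (le_max_right _ _) hY)⟩
  add_mem' := by
    rintro X Y ⟨s, t, hst, hX⟩ ⟨s', t', -, hY⟩
    exact ⟨min s s', max t t', (min_le_left _ _).trans (hst.trans (le_max_left _ _)),
      add_mem (h.localAlg_mono (min_le_left _ _) (le_max_left _ _) hX)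
        (h.localAlg_mono (min_le_right _ _) (le_max_right _ _) hY)⟩
  algebraMap_mem' c := ⟨0, 0, le_rfl, algebraMap_mem _ c⟩
  star_mem' := by
    rintro X ⟨s, t, hst, hX⟩
    exact ⟨s, t, hst, star_mem hX⟩

/-- The C*-algebra of local observables: the norm closure of the union of the local algebras. -/
noncomputable def localCStar : StarSubalgebra ℂ (H →L[ℂ] H) :=
  h.localUnion.topologicalClosure

theorem localAlg_le_localCStar {s t : ℝ} (hst : s ≤ t) : h.localAlg s t ≤ h.localCStar :=
  fun _ hX => h.localUnion.le_topologicalClosure ⟨s, t, hst, hX⟩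

theorem γ_mem_localCStar (r : ℝ) {X : H →L[ℂ] H} (hX : X ∈ h.localCStar) :
    h.γ r X ∈ h.localCStar := by
  have hc : Continuous (h.γ r) :=
    (AddMonoidHomClass.isometry_of_norm (h.γ r) (h.norm_γ r)).continuous
  exact map_mem_closure hc hX fun Y ⟨s, t, hst, hY⟩ =>
    ⟨s + r, t + r, by linarith, h.γ_mem_localAlg r hY⟩

/-- A state of the local C*-algebra is `γ`-invariant. -/
def IsInvariant (φ : State h.localCStar) : Prop :=
  ∀ (t : ℝ) (X : H →L[ℂ] H) (hX : X ∈ h.localCStar),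
    φ.val (h.γ t X) (h.γ_mem_localCStar t hX) = φ.val X hX

end History

variable (H) in
/-- An interaction: a history together with normal states `ω₋` of `M` and `ω₊` of the commutant
`M'`, the first invariant under `γ_t`, `t ≤ 0`, the second under `γ_t`, `t ≥ 0`. -/
structure Interaction extends History H where
  ωm : State M.toStarSubalgebra
  ωp : State M.commutant.toStarSubalgebra
  ωm_normal : State.IsNormal M ωm
  ωp_normal : State.IsNormal M.commutant ωp
  ωm_invariant : ∀ (t : ℝ) (ht : t ≤ 0) (X : H →L[ℂ] H) (hX : X ∈ M),
    ωm.val (toHistory.γ t X) (toHistory.γ_mem ht hX) = ωm.val X hX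
  ωp_invariant : ∀ (t : ℝ) (ht : 0 ≤ t) (X : H →L[ℂ] H) (hX : X ∈ M.commutant),
    ωp.val (toHistory.γ t X) (toHistory.γ_mem_commutant ht hX) = ωp.val X hX

namespace Interaction

variable (I : Interaction H)

/-- `φ` is a `γ`-invariant state of the local C*-algebra which agrees with `ω₋` on the local
algebras of all compact intervals `[s,t] ⊆ (-∞,0]`. -/
def IsPastExtension (φ : State I.localCStar) : Prop :=
  I.IsInvariant φ ∧ ∀ (s t : ℝ) (hst : s ≤ t) (ht : t ≤ 0) (X : H →L[ℂ] H)
    (hX : X ∈ I.localAlg s t),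
    φ.val X (I.localAlg_le_localCStar hst hX) = I.ωm.val X (I.localAlg_le_past ht hX)

/-- `φ` is a `γ`-invariant state of the local C*-algebra which agrees with `ω₊` on the local
algebras of all compact intervals `[s,t] ⊆ [0,∞)`. -/
def IsFutureExtension (φ : State I.localCStar) : Prop :=
  I.IsInvariant φ ∧ ∀ (s t : ℝ) (hst : s ≤ t) (hs : 0 ≤ s) (X : H →L[ℂ] H)
    (hX : X ∈ I.localAlg s t),
    φ.val X (I.localAlg_le_localCStar hst hX) = I.ωp.val X (I.localAlg_le_future hs hX)

theorem isClosed_vN (N : VonNeumannAlgebra H) :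
    IsClosed (N.toStarSubalgebra : Set (H →L[ℂ] H)) := by
  have : (N.toStarSubalgebra : Set (H →L[ℂ] H)) =
      Set.centralizer (Set.centralizer (N : Set (H →L[ℂ] H))) := by simp
  rw [this]
  exact Set.isClosed_centralizer _

theorem existsUnique_pastExtension : ∃! φ : State I.localCStar, I.IsPastExtension φ := by
  obtain ⟨φ, h1, h2⟩ := I.ωm.exists_extension (N := I.M.toStarSubalgebra) (A₀ := I.localUnion)
    (isClosed_vN I.M) (fun t => I.γ (-t)) (fun s t X => by rw [neg_add, I.γ_add])
    (fun t X => I.norm_γ _ X) (fun t ht X hX => I.γ_mem (neg_nonpos.2 ht) hX)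
    (fun t ht X hX _ => I.ωm_invariant (-t) (neg_nonpos.2 ht) X hX)
    (fun X ⟨s, t, hst, hX⟩ => ⟨t, (I.mem_localAlg.1 hX).1⟩)
    (fun r X ⟨s, t, hst, hX⟩ => ⟨s + -r, t + -r, by linarith, I.γ_mem_localAlg (-r) hX⟩)
  refine ⟨φ, ⟨?_, ?_⟩, ?_⟩
  · intro t X hX
    have := h1 (-t) X hX
    simp only [neg_neg] at this
    exact this (I.γ_mem_localCStar t hX)
  · intro s t hst ht X hX
    exact h2 X ⟨s, t, hst, hX⟩ _
  · rintro ψ ⟨h3, h4⟩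
    refine State.ext_closure _ _ ?_
    rintro X ⟨s, t, hst, hX⟩
    have hX' := I.γ_mem_localAlg (-t) hX
    have hl := I.localAlg_le_localCStar hst hX
    have e1 := h4 (s + -t) (t + -t) (by linarith) (by linarith) _ hX'
    have e2 := h2 _ ⟨_, _, by linarith, hX'⟩ (I.localAlg_le_past (by linarith) hX')
    have e3 := h3 (-t) X hl
    have e4 := h1 t X hl (I.γ_mem_localCStar (-t) hl)
    exact e3.symm.trans (e1.trans (e2.symm.trans e4))

theorem existsUnique_futureExtension : ∃! φ : State I.localCStar, I.IsFutureExtension φ := by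
  obtain ⟨φ, h1, h2⟩ := I.ωp.exists_extension (N := I.M.commutant.toStarSubalgebra)
    (A₀ := I.localUnion)
    (isClosed_vN I.M.commutant) (fun t => I.γ t) (fun s t X => I.γ_add s t X)
    (fun t X => I.norm_γ _ X) (fun t ht X hX => I.γ_mem_commutant ht hX)
    (fun t ht X hX _ => I.ωp_invariant t ht X hX)
    (fun X ⟨s, t, hst, hX⟩ => ⟨-s, (I.mem_localAlg.1 hX).2⟩)
    (fun r X ⟨s, t, hst, hX⟩ => ⟨s + r, t + r, by linarith, I.γ_mem_localAlg r hX⟩)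
  refine ⟨φ, ⟨?_, ?_⟩, ?_⟩
  · intro t X hX
    exact h1 t X hX _
  · intro s t hst hs X hX
    exact h2 X ⟨s, t, hst, hX⟩ _
  · rintro ψ ⟨h3, h4⟩
    refine State.ext_closure _ _ ?_
    rintro X ⟨s, t, hst, hX⟩
    have hX' := I.γ_mem_localAlg (-s) hX
    have hl := I.localAlg_le_localCStar hst hX
    have e1 := h4 (s + -s) (t + -s) (by linarith) (by linarith) _ hX'
    have e2 := h2 _ ⟨_, _, by linarith, hX'⟩ (I.localAlg_le_future (by linarith) hX')
    have e3 := h3 (-s) X hl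
    have e4 := h1 (-s) X hl (I.γ_mem_localCStar (-s) hl)
    exact e3.symm.trans (e1.trans (e2.symm.trans e4))

/-- The unique `γ`-invariant extension of `ω₋` to the local C*-algebra. -/
noncomputable def ωmBar : State I.localCStar := I.existsUnique_pastExtension.choose

/-- The unique `γ`-invariant extension of `ω₊` to the local C*-algebra. -/
noncomputable def ωpBar : State I.localCStar := I.existsUnique_futureExtension.choose

/-- An interaction is trivial if the extensions of its past and future states coincide. -/
def IsTrivial : Prop := I.ωmBar = I.ωpBar

end Interaction

end Interactions

end Arveson

set_option linter.unusedSectionVars false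

/-! The eigenvalues of each one-sided state are visible in the local algebras of long intervals. Let
`N` be `M` with the maps γ_{-t}, or `M'` with the maps γ_t, for t ≥ 0. Identify `N` with `B(K)`, let
β_t be the resulting endomorphisms, and let ω be the invariant normal state, with a density having
orthonormal eigenvectors e_j for the positive eigenvalues λ_j. Purity forces every weak limit point
of an orbit β_n(T) to be scalar, and invariance identifies the scalar, so β_n(T) → ω(T)1 weakly
(`IsPureSemigroup.tendsto_inner`).

Operators g, h with β(T)g = gT and β(T)h = hT have a scalar product g*h ∈ ℂ1, and each gg* lies in
the relative commutant of β and behaves there like a rank one operator. For g_ij(u) =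
β(|u⟩⟨e_j|/√λ_j) e_i the weak convergence makes the family (g_ij) asymptotically orthonormal, and
ω(g_ij g_ij*) is asymptotically at least λ_i λ_j. Thus the restriction of ω to the relative
commutant acquires the spectrum of Λ ⊗ Λ in the limit. This is expressed by two bounds for families
of minimal elements: a lower one, `IsPureSemigroup.eventually_exists_isMinimalFamily`, and an upper
one of Ky Fan type, `IsPureSemigroup.eventually_sum_le`.

The relative commutants of the two sides are the algebras of [-t,0] and [0,t], and γ_t maps the
first onto the second. If the interaction is trivial, it also carries ω₋ to ω₊ there. The two
bounds, applied on opposite sides, then exclude a first index at which the lists differ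
(`eigenvalue_le_of_forall_lt_eq`).

What remains is standard: a normal state of a type I factor has a density with an eigenbasis
matching its list (`State.IsNormal.exists_hasEigenvalueList`,
`State.HasEigenvalueList.exists_isDiagonalized`), and the commutant of a type I factor is of type I
(`IsTypeIFactor.commutant`). -/

namespace Arveson

open InnerProductSpace ContinuousLinearMap Filter Topology

/-! ### Intertwiners between the identity representation of B(K) and another one. -/

section Intertwiner

variable {K L : Type*} [NormedAddCommGroup K] [InnerProductSpace ℂ K] [CompleteSpace K]
  [NormedAddCommGroup L] [InnerProductSpace ℂ L] [CompleteSpace L]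

/-- For a representation `β` of `B(K)` on `L`, the operator `u ↦ β(|u⟩⟨y|) x` from `K` to `L`. It
intertwines the identity representation of `B(K)` with `β`. -/
noncomputable def intertwiner (β : (K →L[ℂ] K) →⋆ₐ[ℂ] (L →L[ℂ] L)) (x : L) (y : K) : K →L[ℂ] L :=
  LinearMap.mkContinuous
    { toFun := fun u => β (rankOne ℂ u y) x
      map_add' := fun u v => by simp
      map_smul' := fun c u => by simp } (‖y‖ * ‖x‖) (fun u => by
        have h1 := NonUnitalStarAlgHom.norm_apply_le β (rankOne ℂ u y)
        rw [norm_rankOne] at h1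
        have h2 := (β (rankOne ℂ u y)).le_opNorm x
        calc _ ≤ ‖β (rankOne ℂ u y)‖ * ‖x‖ := h2
          _ ≤ (‖u‖ * ‖y‖) * ‖x‖ := by gcongr
          _ = _ := by ring)

variable (β : (K →L[ℂ] K) →⋆ₐ[ℂ] (L →L[ℂ] L))

theorem intertwiner_apply (x : L) (y u : K) : intertwiner β x y u = β (rankOne ℂ u y) x := rfl

theorem map_apply_intertwiner (T : K →L[ℂ] K) (x : L) (y u : K) :
    β T (intertwiner β x y u) = intertwiner β x y (T u) := by
  rw [intertwiner_apply, intertwiner_apply, ← mul_apply_eq_comp, ← map_mul,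
    ContinuousLinearMap.mul_def, comp_rankOne]

theorem inner_map_left (T : K →L[ℂ] K) (x z : L) : ⟪β T x, z⟫_ℂ = ⟪x, β (star T) z⟫_ℂ := by
  rw [map_star, ContinuousLinearMap.star_eq_adjoint, ContinuousLinearMap.adjoint_inner_right]

theorem star_rankOne (x y : K) : star (rankOne ℂ x y) = rankOne ℂ y x := by
  rw [ContinuousLinearMap.star_eq_adjoint, adjoint_rankOne]

theorem rankOne_mul_rankOne (x y z w : K) :
    rankOne ℂ x y * rankOne ℂ z w = ⟪y, z⟫_ℂ • rankOne ℂ x w := by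
  rw [ContinuousLinearMap.mul_def, rankOne_comp_rankOne]

/-- Since Y commutes with β, β(|y⟩⟨u|) Y β(|v⟩⟨y'|) = ⟨u,v⟩ Y β(|y⟩⟨y'|). Hence g*Yg' is a scalar, a
matrix coefficient of Y on the space of intertwiners; Y = 1 gives the Gram matrix. -/
theorem inner_intertwiner_apply {Y : L →L[ℂ] L} (hY : ∀ T, Commute Y (β T)) (x x' : L)
    (y y' u v : K) :
    ⟪intertwiner β x y u, Y (intertwiner β x' y' v)⟫_ℂ =
      ⟪u, v⟫_ℂ * ⟪x, Y (β (rankOne ℂ y y') x')⟫_ℂ := by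
  have h : β (rankOne ℂ y u) * Y * β (rankOne ℂ v y') = ⟪u, v⟫_ℂ • (Y * β (rankOne ℂ y y')) := by
    rw [← (hY _).eq, mul_assoc, ← map_mul, rankOne_mul_rankOne, map_smul, mul_smul_comm]
  rw [intertwiner_apply, intertwiner_apply, inner_map_left, star_rankOne]
  have h2 := congrArg (fun Z => ⟪x, Z x'⟫_ℂ) h
  simpa [inner_smul_right] using h2

theorem inner_intertwiner (x x' : L) (y y' u v : K) :
    ⟪intertwiner β x y u, intertwiner β x' y' v⟫_ℂ =
      ⟪u, v⟫_ℂ * ⟪x, β (rankOne ℂ y y') x'⟫_ℂ := by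
  simpa using inner_intertwiner_apply β (Y := 1) (fun T => Commute.one_left _) x x' y y' u v

theorem adjoint_intertwiner_comp {Y : L →L[ℂ] L} (hY : ∀ T, Commute Y (β T)) (x x' : L)
    (y y' v : K) :
    adjoint (intertwiner β x y) (Y (intertwiner β x' y' v)) =
      ⟪x, Y (β (rankOne ℂ y y') x')⟫_ℂ • v := by
  refine ext_inner_left ℂ fun u => ?_
  rw [adjoint_inner_right, inner_intertwiner_apply β hY, inner_smul_right, mul_comm]

/-- From β(T)g = gT and its adjoint g*β(T) = Tg*, both gg'*β(T) and β(T)gg'* equal gTg'*. -/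
theorem commute_intertwiner_comp_adjoint (x x' : L) (y y' : K) (T : K →L[ℂ] K) :
    Commute (intertwiner β x y ∘L adjoint (intertwiner β x' y')) (β T) := by
  ext z
  change intertwiner β x y (adjoint (intertwiner β x' y') (β T z)) =
    β T (intertwiner β x y (adjoint (intertwiner β x' y') z))
  rw [map_apply_intertwiner]
  congr 1
  refine ext_inner_left ℂ fun u => ?_
  rw [adjoint_inner_right, ← adjoint_inner_left, ← adjoint_inner_left,
    adjoint_inner_right, ← star_eq_adjoint (β T), ← map_star, map_apply_intertwiner,
    star_eq_adjoint]

/-- An approximate Bessel inequality for a finite family of intertwiners whose Gram matrix is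
close to the identity. -/
theorem sum_norm_adjoint_intertwiner_sq_le {A : Type*} [Fintype A] [DecidableEq A]
    (x : A → L) (y : A → K) {η : ℝ}
    (hΓ : ∀ a b, ‖⟪x a, β (rankOne ℂ (y a) (y b)) (x b)⟫_ℂ - if a = b then 1 else 0‖ ≤ η) (z : L) :
    ∑ a, ‖adjoint (intertwiner β (x a) (y a)) z‖ ^ 2 ≤ (1 + Fintype.card A * η) * ‖z‖ ^ 2 := by
  set g := fun a => intertwiner β (x a) (y a) with hg
  set f : A → K := fun a => adjoint (g a) z with hf
  set S := ∑ a, ‖f a‖ ^ 2 with hS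
  have hS0 : 0 ≤ S := Finset.sum_nonneg fun _ _ => by positivity
  rcases isEmpty_or_nonempty A with hA | hA
  · simp [hS]
  have hη : 0 ≤ η := (norm_nonneg _).trans (hΓ hA.some hA.some)
  -- Duality argument: with w = ∑ g_a g_a* z one has ⟨z,w⟩ = S and ‖w‖² ≤ (1 + |A|η)S, so
  -- Cauchy–Schwarz for ⟨z,w⟩ bounds S.
  set w : L := ∑ a, g a (f a) with hw
  have h1 : ⟪z, w⟫_ℂ = (S : ℂ) := by
    rw [hw, inner_sum, hS]
    push_cast
    refine Finset.sum_congr rfl fun a _ => ?_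
    rw [← adjoint_inner_left, inner_self_eq_norm_sq_to_K]
    rfl
  have h2 : ‖w‖ ^ 2 ≤ (1 + Fintype.card A * η) * S := by
    have h3 : ⟪w, w⟫_ℂ = ∑ a, ∑ b, ⟪f a, f b⟫_ℂ * ⟪x a, β (rankOne ℂ (y a) (y b)) (x b)⟫_ℂ := by
      rw [hw, sum_inner]
      refine Finset.sum_congr rfl fun a _ => ?_
      rw [inner_sum]
      refine Finset.sum_congr rfl fun b _ => ?_
      rw [inner_intertwiner]
    have h4 : ⟪w, w⟫_ℂ - (S : ℂ) = ∑ a, ∑ b, ⟪f a, f b⟫_ℂ *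
        (⟪x a, β (rankOne ℂ (y a) (y b)) (x b)⟫_ℂ - if a = b then 1 else 0) := by
      rw [h3, hS]
      simp only [mul_sub, Finset.sum_sub_distrib, mul_ite, mul_one, mul_zero, Finset.sum_ite_eq,
        Finset.mem_univ, if_true, inner_self_eq_norm_sq_to_K]
      simp
    -- Only the deviation of the Gram matrix from the identity contributes, each entry costing at
    -- most η; the factor |A| then comes from (∑‖f a‖)² ≤ |A| S.
    have h5 : ‖⟪w, w⟫_ℂ - (S : ℂ)‖ ≤ η * (∑ a, ‖f a‖) ^ 2 := by
      rw [h4, sq, Finset.sum_mul_sum, Finset.mul_sum]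
      refine (norm_sum_le _ _).trans (Finset.sum_le_sum fun a _ => ?_)
      rw [Finset.mul_sum]
      refine (norm_sum_le _ _).trans (Finset.sum_le_sum fun b _ => ?_)
      rw [norm_mul, mul_comm]
      exact mul_le_mul (hΓ a b) (norm_inner_le_norm _ _) (norm_nonneg _) hη
    have h6 : (∑ a, ‖f a‖) ^ 2 ≤ Fintype.card A * S := by
      simpa using sq_sum_le_card_mul_sum_sq (s := Finset.univ) (f := fun a => ‖f a‖)
    have h7 : ‖w‖ ^ 2 - S ≤ η * (∑ a, ‖f a‖) ^ 2 := by
      refine le_trans ?_ h5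
      rw [inner_self_eq_norm_sq_to_K]
      have : ((‖w‖ : ℂ) ^ 2 - (S : ℂ)) = ((‖w‖ ^ 2 - S : ℝ) : ℂ) := by push_cast; rfl
      change _ ≤ ‖((‖w‖ : ℂ) ^ 2 - (S : ℂ))‖
      rw [this, Complex.norm_real]
      exact le_abs_self _
    nlinarith [mul_le_mul_of_nonneg_left h6 hη]
  have h8 : S ≤ ‖z‖ * ‖w‖ := by
    have := norm_inner_le_norm (𝕜 := ℂ) z w
    rw [h1, Complex.norm_real, Real.norm_of_nonneg hS0] at this
    exact this
  have h9 : S * S ≤ ((1 + Fintype.card A * η) * ‖z‖ ^ 2) * S := by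
    calc S * S ≤ (‖z‖ * ‖w‖) * (‖z‖ * ‖w‖) := by gcongr
      _ = ‖z‖ ^ 2 * ‖w‖ ^ 2 := by ring
      _ ≤ ‖z‖ ^ 2 * ((1 + Fintype.card A * η) * S) := by gcongr
      _ = _ := by ring
  rcases hS0.eq_or_lt with h0 | h0
  · rw [← h0]; positivity
  · exact le_of_mul_le_mul_right h9 h0

end Intertwiner

/-! ### Positive operators and quadratic forms. -/

section Positivity

variable {K : Type*} [NormedAddCommGroup K] [InnerProductSpace ℂ K] [CompleteSpace K]

theorem re_inner_nonneg_of_nonneg {T : K →L[ℂ] K} (hT : 0 ≤ T) (x : K) : 0 ≤ (⟪x, T x⟫_ℂ).re :=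
  ((nonneg_iff_isPositive T).1 hT).re_inner_nonneg_right x

theorem nonneg_of_isSelfAdjoint {T : K →L[ℂ] K} (hT : IsSelfAdjoint T)
    (h : ∀ x, 0 ≤ (⟪x, T x⟫_ℂ).re) : 0 ≤ T := by
  rw [nonneg_iff_isPositive, isPositive_def]
  refine ⟨hT.isSymmetric, fun x => ?_⟩
  rw [reApplyInnerSelf_apply, inner_re_symm]
  exact h x

theorem comp_adjoint_nonneg {L : Type*} [NormedAddCommGroup L] [InnerProductSpace ℂ L]
    [CompleteSpace L] (g : K →L[ℂ] L) : 0 ≤ g ∘L adjoint g := by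
  rw [nonneg_iff_isPositive]
  exact isPositive_one.conj_adjoint g

end Positivity

/-! ### Minimal elements of the relative commutant. -/

section Minimal

variable {K : Type*} [NormedAddCommGroup K] [InnerProductSpace ℂ K] [CompleteSpace K]

/-- A finite family of positive elements of `C` with sum at most `1` such that each `p a` is
minimal, that is, `p a Y p a` is a multiple of `p a` for every `Y ∈ C`. -/
structure IsMinimalFamily {A : Type*} [Fintype A] (C : Set (K →L[ℂ] K)) (p : A → K →L[ℂ] K) :
    Prop where
  mem : ∀ a, p a ∈ C
  nonneg : ∀ a, 0 ≤ p a
  sum_le_one : ∑ a, p a ≤ 1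
  minimal : ∀ a, ∀ Y ∈ C, ∃ z : ℂ, p a * Y * p a = z • p a

/-- The elements commuting with the range of an endomorphism. -/
def relCommutant (β : (K →L[ℂ] K) →⋆ₐ[ℂ] (K →L[ℂ] K)) : Set (K →L[ℂ] K) :=
  {Y | ∀ T, Commute Y (β T)}

variable (β : (K →L[ℂ] K) →⋆ₐ[ℂ] (K →L[ℂ] K)) {J : Type*} {lam : J → ℝ}
  {e : J → K} {w : (K →L[ℂ] K) →ₗ[ℝ] ℝ}

theorem real_smul_conj (r : ℝ) {z : ℂ} {X Y : K →L[ℂ] K} (h : X * Y * X = z • X) :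
    (r • X) * Y * (r • X) = ((r : ℂ) * z) • (r • X) := by
  ext v
  have hv : X (Y (X v)) = z • X v := congrArg (fun T : K →L[ℂ] K => T v) h
  simp only [mul_apply_eq_comp, smul_apply, ← Complex.coe_smul, map_smul, hv, smul_smul]
  congr 1
  ring

/-- Because g*Yg is a scalar, gg*Ygg* is a multiple of gg*: this is the minimality of gg*. -/
theorem intertwiner_conj {Y : K →L[ℂ] K} (hY : Y ∈ relCommutant β) (x y : K) :
    (intertwiner β x y ∘L adjoint (intertwiner β x y)) * Y *
      (intertwiner β x y ∘L adjoint (intertwiner β x y)) =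
      ⟪x, Y (β (rankOne ℂ y y) x)⟫_ℂ • (intertwiner β x y ∘L adjoint (intertwiner β x y)) := by
  ext z
  have h := adjoint_intertwiner_comp β hY x x y y (adjoint (intertwiner β x y) z)
  simp only [mul_apply_eq_comp, comp_apply, smul_apply, h, map_smul]

/-- The approximate Bessel inequality gives ∑ gg* ≤ 1 + |A|η, which explains the normalizing factor.
-/
theorem isMinimalFamily_intertwiner {A : Type*} [Fintype A] [DecidableEq A]
    (x y : A → K) {η : ℝ} (hη : 0 ≤ η)
    (hΓ : ∀ a b, ‖⟪x a, β (rankOne ℂ (y a) (y b)) (x b)⟫_ℂ - if a = b then 1 else 0‖ ≤ η) :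
    IsMinimalFamily (relCommutant β) fun a => ((1 + Fintype.card A * η)⁻¹ : ℝ) •
      (intertwiner β (x a) (y a) ∘L adjoint (intertwiner β (x a) (y a))) where
  mem a T := (commute_intertwiner_comp_adjoint β _ _ _ _ T).smul_left _
  nonneg a := smul_nonneg (by positivity) (comp_adjoint_nonneg _)
  sum_le_one := by
    rw [← sub_nonneg]
    have hsa : ∀ a, IsSelfAdjoint
        (intertwiner β (x a) (y a) ∘L adjoint (intertwiner β (x a) (y a))) :=
      fun a => (comp_adjoint_nonneg _).isSelfAdjoint
    refine nonneg_of_isSelfAdjoint ?_ fun z => ?_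
    · refine (IsSelfAdjoint.one _).sub (isSelfAdjoint_sum _ fun a _ => ?_)
      exact (IsSelfAdjoint.all _).smul (hsa a)
    · have h := sum_norm_adjoint_intertwiner_sq_le β x y hΓ z
      have h0 : (0 : ℝ) < 1 + Fintype.card A * η := by positivity
      rw [← Finset.smul_sum]
      simp only [sub_apply, one_apply_eq_self,
        smul_apply, sum_apply, inner_sub_right,
        Complex.sub_re, sub_nonneg]
      rw [← Complex.coe_smul, inner_smul_right, inner_sum, Complex.re_ofReal_mul, Complex.re_sum,
        inv_mul_le_iff₀ h0]
      refine le_of_eq_of_le (Finset.sum_congr rfl fun a _ => ?_) (h.trans_eq ?_)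
      · rw [comp_apply, ← adjoint_inner_left, inner_self_eq_norm_sq_to_K]
        norm_cast
      · rw [inner_self_eq_norm_sq_to_K]
        norm_cast
  minimal a Y hY := by
    exact ⟨_, real_smul_conj _ (intertwiner_conj β hY (x a) (y a))⟩

/-- A lower bound for the values of a normal invariant state on the minimal elements of the
relative commutant which come from intertwiners. -/
theorem le_apply_intertwiner_comp_adjoint (hlam : ∀ j, 0 < lam j) (he : Orthonormal ℂ e)
    (hw : ∀ T, HasSum (fun j => lam j * (⟪e j, T (e j)⟫_ℂ).re) (w T)) (i j : J) {η : ℝ}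
    (hη1 : η ≤ 1) (hΓ : ‖⟪e i, β (rankOne ℂ (((√(lam j))⁻¹ : ℝ) • e j) (((√(lam j))⁻¹ : ℝ) • e j))
      (e i)⟫_ℂ - 1‖ ≤ η) :
    lam i * lam j * (1 - η) ^ 2 ≤ w (intertwiner β (e i) (((√(lam j))⁻¹ : ℝ) • e j) ∘L
      adjoint (intertwiner β (e i) (((√(lam j))⁻¹ : ℝ) • e j))) := by
  set g := intertwiner β (e i) (((√(lam j))⁻¹ : ℝ) • e j) with hg
  have hs : 0 < √(lam j) := Real.sqrt_pos.2 (hlam j)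
  -- Of the sum over eigenvectors that gives the state, only the term of e_i is kept.
  have h1 : lam i * (⟪e i, (g ∘L adjoint g) (e i)⟫_ℂ).re ≤ w (g ∘L adjoint g) := by
    exact le_hasSum (hw _) i fun k _ =>
      mul_nonneg (hlam k).le (re_inner_nonneg_of_nonneg (comp_adjoint_nonneg _) _)
  have h2 : (⟪e i, (g ∘L adjoint g) (e i)⟫_ℂ).re = ‖adjoint g (e i)‖ ^ 2 := by
    rw [comp_apply, ← adjoint_inner_left, inner_self_eq_norm_sq_to_K]
    norm_cast
  -- Testing g*e_i against e_j is enough: ⟨e_i, g e_j⟩ is √λ_j times a diagonal Gram entry, which is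
  -- within η of 1.
  have h3 : ‖⟪adjoint g (e i), e j⟫_ℂ‖ ≤ ‖adjoint g (e i)‖ := by
    simpa [he.1 j] using norm_inner_le_norm (𝕜 := ℂ) (adjoint g (e i)) (e j)
  have h4 : ⟪adjoint g (e i), e j⟫_ℂ = (√(lam j) : ℂ) * ⟪e i, β (rankOne ℂ
      (((√(lam j))⁻¹ : ℝ) • e j) (((√(lam j))⁻¹ : ℝ) • e j)) (e i)⟫_ℂ := by
    have h : e j = (√(lam j) : ℂ) • (((√(lam j))⁻¹ : ℝ) • e j) := by
      rw [Complex.coe_smul, smul_smul, mul_inv_cancel₀ hs.ne', one_smul]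
    rw [adjoint_inner_left]
    conv_lhs => rw [h]
    rw [map_smul, inner_smul_right, hg, intertwiner_apply]
  have h5 : √(lam j) * (1 - η) ≤ ‖adjoint g (e i)‖ := by
    refine le_trans ?_ h3
    rw [h4, norm_mul, Complex.norm_real, Real.norm_of_nonneg hs.le]
    gcongr
    have := norm_sub_norm_le (1 : ℂ) ⟪e i, β (rankOne ℂ
      (((√(lam j))⁻¹ : ℝ) • e j) (((√(lam j))⁻¹ : ℝ) • e j)) (e i)⟫_ℂ
    rw [norm_sub_rev, norm_one] at this
    linarith
  have h6 : lam j * (1 - η) ^ 2 ≤ ‖adjoint g (e i)‖ ^ 2 := by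
    calc _ = (√(lam j) * (1 - η)) ^ 2 := by rw [mul_pow, Real.sq_sqrt (hlam j).le]
      _ ≤ _ := by
        have : 0 ≤ 1 - η := by linarith
        gcongr
  rw [h2] at h1
  refine le_trans ?_ h1
  rw [mul_assoc]
  exact mul_le_mul_of_nonneg_left h6 (hlam i).le

end Minimal

/-! ### The upper bound for minimal families at a fixed time. -/

section Upper

variable {K : Type*} [NormedAddCommGroup K] [InnerProductSpace ℂ K] [CompleteSpace K]
  (β : (K →L[ℂ] K) →⋆ₐ[ℂ] (K →L[ℂ] K))

/-- Conjugating p ≤ 1 by √p gives p² ≤ p. -/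
theorem norm_apply_sq_le {p : K →L[ℂ] K} (hp : 0 ≤ p) (hp1 : p ≤ 1) (u : K) :
    ‖p u‖ ^ 2 ≤ (⟪u, p u⟫_ℂ).re := by
  have h1 : p * p ≤ p := by
    have h2 : CFC.sqrt p * p * CFC.sqrt p ≤ CFC.sqrt p * 1 * CFC.sqrt p :=
      (CFC.sqrt_nonneg p).isSelfAdjoint.conjugate_le_conjugate hp1
    have h3 : CFC.sqrt p * CFC.sqrt p = p := CFC.sqrt_mul_sqrt_self p hp
    have h4 : ∀ a : K →L[ℂ] K, a * a = p → a * p * a = p * p := fun a ha => by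
      rw [← ha]
      simp only [mul_assoc]
    rwa [mul_one, h3, h4 _ h3] at h2
  have h5 := re_inner_nonneg_of_nonneg (sub_nonneg.2 h1) u
  have h6 : ⟪u, (p * p) u⟫_ℂ = (‖p u‖ : ℂ) ^ 2 := by
    rw [mul_apply_eq_comp, ← adjoint_inner_left, ← star_eq_adjoint, hp.isSelfAdjoint.star_eq,
      inner_self_eq_norm_sq_to_K]
    rfl
  rw [sub_apply, inner_sub_right, h6, Complex.sub_re] at h5
  norm_cast at h5
  linarith

/-- A minimal p with 0 ≤ p ≤ 1 acts on the intertwiners like a rank one operator of trace at most 1,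
and the sum is its partial trace over an almost orthonormal family. A trace is avoided by fixing u
with pu ≠ 0: the numbers s_a⟨u,pu⟩ are dominated by ‖g_a*pu‖², and approximate Bessel together with
‖pu‖² ≤ ⟨u,pu⟩ finishes. -/
theorem sum_inner_intertwiner_le {A : Type*} [Fintype A] [DecidableEq A] {p : K →L[ℂ] K}
    (hp : 0 ≤ p) (hp1 : p ≤ 1) (hpβ : p ∈ relCommutant β)
    (hmin : ∀ Y ∈ relCommutant β, ∃ z : ℂ, p * Y * p = z • p) (x y : A → K) {η : ℝ} (hη : 0 ≤ η)
    (hΓ : ∀ a b, ‖⟪x a, β (rankOne ℂ (y a) (y b)) (x b)⟫_ℂ - if a = b then 1 else 0‖ ≤ η) :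
    ∑ a, (⟪x a, p (β (rankOne ℂ (y a) (y a)) (x a))⟫_ℂ).re ≤ 1 + Fintype.card A * η := by
  by_cases hp0 : p = 0
  · simp only [hp0, zero_apply, inner_zero_right, Complex.zero_re,
      Finset.sum_const_zero]
    positivity
  obtain ⟨u, hu⟩ : ∃ u, p u ≠ 0 := by
    by_contra! h
    exact hp0 (ContinuousLinearMap.ext h)
  set q := (⟪u, p u⟫_ℂ).re with hq
  have hpu := norm_apply_sq_le hp hp1 u
  have hq0 : 0 < q := lt_of_lt_of_le (by positivity) hpu
  have hqc : ⟪u, p u⟫_ℂ = (q : ℂ) := by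
    have := ((nonneg_iff_isPositive p).1 hp).inner_nonneg_right u
    exact Complex.ext rfl (by simpa using (Complex.nonneg_iff.1 this).2.symm)
  have key : ∀ a, (⟪x a, p (β (rankOne ℂ (y a) (y a)) (x a))⟫_ℂ).re * q ≤
      ‖adjoint (intertwiner β (x a) (y a)) (p u)‖ ^ 2 := by
    intro a
    set s := ⟪x a, p (β (rankOne ℂ (y a) (y a)) (x a))⟫_ℂ with hs
    set g := intertwiner β (x a) (y a) with hg
    have h1 : ∀ v, adjoint g (p (g v)) = s • v := fun v =>
      adjoint_intertwiner_comp β hpβ (x a) (x a) (y a) (y a) v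
    obtain ⟨z, hz⟩ := hmin _ fun T => commute_intertwiner_comp_adjoint β (x a) (x a) (y a) (y a) T
    have hz' : ∀ v, p (g (adjoint g (p v))) = z • p v := fun v =>
      congrArg (fun T : K →L[ℂ] K => T v) hz
    by_cases h2 : ∀ v, p (g v) = 0
    · have h3 : s = 0 := by
        have := h1 u
        rw [h2, map_zero, eq_comm, smul_eq_zero] at this
        exact this.resolve_right fun h => hu (by rw [h, map_zero])
      rw [h3, Complex.zero_re, zero_mul]
      positivity
    · push Not at h2
      obtain ⟨v, hv⟩ := h2
      -- Evaluate p g g* p on g v in two ways: g*pg = s gives s·pgv, minimality of p gives z·pgv.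
      have h3 : s = z := by
        have := hz' (g v)
        rw [h1, map_smul, map_smul] at this
        exact smul_left_injective ℂ hv this
      have h4 : (‖adjoint g (p u)‖ : ℂ) ^ 2 = s * q := by
        have hpa : adjoint p = p := hp.isSelfAdjoint.star_eq
        rw [h3, ← hqc, ← inner_smul_right, ← hz', ← adjoint_inner_left, hpa, ← adjoint_inner_left, inner_self_eq_norm_sq_to_K]
        rfl
      have h5 := congrArg Complex.re h4
      rw [Complex.re_mul_ofReal] at h5
      rw [← h5]
      norm_cast
  have h1 : (∑ a, (⟪x a, p (β (rankOne ℂ (y a) (y a)) (x a))⟫_ℂ).re) * q ≤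
      (1 + Fintype.card A * η) * q := by
    rw [Finset.sum_mul]
    refine (Finset.sum_le_sum fun a _ => key a).trans ?_
    refine (sum_norm_adjoint_intertwiner_sq_le β x y hΓ (p u)).trans ?_
    gcongr
  exact le_of_mul_le_mul_right h1 hq0

variable {J : Type*} {lam : J → ℝ} {e : J → K} {w : (K →L[ℂ] K) →ₗ[ℝ] ℝ}

/-- An upper bound for the values of a normal invariant state on a minimal family in the relative
commutant of an endomorphism. -/
theorem sum_apply_isMinimalFamily_le [DecidableEq J] {A : Type*} [Fintype A] {p : A → K →L[ℂ] K}
    (hp : IsMinimalFamily (relCommutant β) p)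
    (hlam : ∀ j, 0 < lam j) (he : Orthonormal ℂ e)
    (hw : ∀ T, HasSum (fun j => lam j * (⟪e j, T (e j)⟫_ℂ).re) (w T)) (hsum : HasSum lam 1)
    (hinv : ∀ T, w (β T) = w T) (F : Finset J) {ε : ℝ} (hF : 1 - ε ≤ ∑ j ∈ F, lam j)
    {η : ℝ} (hη : 0 ≤ η)
    (hΓ : ∀ a b : F × F, ‖⟪e a.1, β (rankOne ℂ (((√(lam a.2))⁻¹ : ℝ) • e a.2)
      (((√(lam b.2))⁻¹ : ℝ) • e b.2)) (e b.1)⟫_ℂ - if a = b then 1 else 0‖ ≤ η)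
    {c B : ℝ} (hc : 0 ≤ c)
    (hB : ∀ S : Finset (J × J), ∑ b ∈ S, max (lam b.1 * lam b.2 - c) 0 ≤ B) :
    ∑ a, w (p a) ≤ (1 + Fintype.card (F × F) * η) * (B + c * Fintype.card A) + 2 * ε := by
  set v : J → K := fun j => ((√(lam j))⁻¹ : ℝ) • e j with hv
  set X := ∑ a, p a with hX
  have hX0 : 0 ≤ X := Finset.sum_nonneg fun a _ => hp.nonneg a
  have hX1 : X ≤ 1 := hp.sum_le_one
  have hXβ : ∀ T, Commute X (β T) := fun T => Commute.sum_left _ _ _ fun a _ => hp.mem a T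
  have hmono : ∀ {S T : K →L[ℂ] K}, S ≤ T → w S ≤ w T := by
    intro S T h
    refine hasSum_le (fun j => ?_) (hw S) (hw T)
    have := re_inner_nonneg_of_nonneg (sub_nonneg.2 h) (e j)
    rw [sub_apply, inner_sub_right, Complex.sub_re, sub_nonneg] at this
    exact mul_le_mul_of_nonneg_left this (hlam j).le
  have hw1 : w 1 = 1 := by
    refine (hw 1).unique ?_
    simpa [inner_self_eq_norm_sq_to_K, he.1] using hsum
  -- Cutting down to the finitely many eigenvectors in F costs ε twice: once for β(1 - q), once for
  -- the terms of the state outside F.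
  set q : K →L[ℂ] K := ∑ j ∈ F, rankOne ℂ (e j) (e j) with hq
  have hqe : ∀ j ∈ F, q (e j) = e j := by
    intro j hj
    rw [hq, sum_apply, Finset.sum_eq_single j]
    · simp [inner_self_eq_norm_sq_to_K, he.1]
    · intro b _ hb
      simp [he.2 hb]
    · exact fun h => absurd hj h
  have hqsa : IsSelfAdjoint q := isSelfAdjoint_sum _ fun j _ => star_rankOne _ _
  have hqq : q * q = q := by
    conv_lhs => rw [hq]
    conv_rhs => rw [hq]
    rw [Finset.mul_sum]
    refine Finset.sum_congr rfl fun j hj => ?_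
    rw [← hq, ContinuousLinearMap.mul_def, comp_rankOne, hqe j hj]
  have hq1q : (1 - q) * (1 - q) = 1 - q := by
    rw [mul_sub, mul_one, sub_mul, hqq, one_mul, sub_self, sub_zero]
  -- Since Y commutes with the projection β(r), Yβ(r) = β(r)Yβ(r).
  have hpos : ∀ {Y : K →L[ℂ] K} {r : K →L[ℂ] K}, 0 ≤ Y → (∀ T, Commute Y (β T)) →
      IsSelfAdjoint r → r * r = r → 0 ≤ Y * β r := by
    intro Y r hY hYβ hr hrr
    have h1 : IsSelfAdjoint (β r) := hr.map β
    have h2 := h1.conjugate_nonneg hY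
    rwa [← (hYβ r).eq, mul_assoc, ← map_mul, hrr] at h2
  have h1X : ∀ T, Commute (1 - X) (β T) := fun T => (Commute.one_left _).sub_left (hXβ T)
  -- X ≤ 1 reduces this to w(β(1 - q)), which equals w(1 - q) by invariance.
  have hstep1 : w (X * β (1 - q)) ≤ ε := by
    have h1 : X * β (1 - q) ≤ β (1 - q) := by
      rw [← sub_nonneg]
      have := hpos (sub_nonneg.2 hX1) h1X ((IsSelfAdjoint.one _).sub hqsa) hq1q
      rwa [sub_mul, one_mul] at this
    have h2 : ∑ j ∈ F, lam j ≤ w q := by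
      refine le_trans (le_of_eq (Finset.sum_congr rfl fun j hj => ?_)) (sum_le_hasSum F
        (fun j _ => mul_nonneg (hlam j).le (re_inner_nonneg_of_nonneg ?_ (e j))) (hw q))
      · rw [hqe j hj]
        simp [inner_self_eq_norm_sq_to_K, he.1]
      · have := hqsa.mul_self_nonneg
        rwa [hqq] at this
    have h3 := hmono h1
    rw [hinv, map_sub w, hw1] at h3
    linarith
  set Z := X * β q with hZ
  have hZ1 : Z ≤ 1 := by
    have h1 : Z ≤ X := by
      rw [← sub_nonneg]
      have := hpos hX0 hXβ ((IsSelfAdjoint.one _).sub hqsa) hq1q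
      rwa [map_sub, map_one, mul_sub, mul_one] at this
    exact h1.trans hX1
  have hstep2 : w Z ≤ ε + ∑ i ∈ F, lam i * (⟪e i, Z (e i)⟫_ℂ).re := by
    have h1 := sum_le_hasSum F (fun j _ => mul_nonneg (hlam j).le
      (re_inner_nonneg_of_nonneg (sub_nonneg.2 hZ1) (e j))) (hw (1 - Z))
    rw [map_sub, hw1] at h1
    have h2 : ∑ i ∈ F, lam i * (⟪e i, (1 - Z) (e i)⟫_ℂ).re =
        ∑ i ∈ F, lam i - ∑ i ∈ F, lam i * (⟪e i, Z (e i)⟫_ℂ).re := by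
      rw [← Finset.sum_sub_distrib]
      refine Finset.sum_congr rfl fun i _ => ?_
      rw [sub_apply, inner_sub_right, Complex.sub_re]
      simp [inner_self_eq_norm_sq_to_K, he.1, mul_sub]
    rw [h2] at h1
    linarith
  have hwX : w X = w Z + w (X * β (1 - q)) := by
    rw [← map_add, hZ, ← mul_add, ← map_add, add_sub_cancel, map_one, mul_one]
  -- s b is the diagonal coefficient of X at the intertwiner of b = (i,j). Replacing |e_j⟩⟨e_j| by
  -- λ_j|v_j⟩⟨v_j| produces the weights λ_iλ_j.
  set s : F × F → ℝ := fun b => (⟪e b.1, X (β (rankOne ℂ (v b.2) (v b.2)) (e b.1))⟫_ℂ).re with hs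
  have hvr : ∀ j, rankOne ℂ (e j) (e j) = (lam j : ℂ) • rankOne ℂ (v j) (v j) := by
    intro j
    have h0 : 0 < √(lam j) := Real.sqrt_pos.2 (hlam j)
    have h1 : (lam j : ℂ) = (√(lam j) : ℂ) * (√(lam j) : ℂ) := by
      rw [← Complex.ofReal_mul, Real.mul_self_sqrt (hlam j).le]
    ext u
    simp only [hv, smul_apply, rankOne_apply, ← Complex.coe_smul, inner_smul_left, smul_smul]
    congr 1
    rw [h1]
    have : (√(lam j) : ℂ) ≠ 0 := by exact_mod_cast h0.ne'
    simp
    field_simp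
  have hsplit : ∑ i ∈ F, lam i * (⟪e i, Z (e i)⟫_ℂ).re =
      ∑ b : F × F, lam b.1 * lam b.2 * s b := by
    rw [Fintype.sum_prod_type, ← Finset.sum_coe_sort F]
    refine Finset.sum_congr rfl fun i _ => ?_
    rw [hZ, hq, map_sum, Finset.mul_sum, sum_apply, inner_sum, Complex.re_sum, Finset.mul_sum,
      ← Finset.sum_coe_sort F]
    refine Finset.sum_congr rfl fun j _ => ?_
    rw [hvr, map_smul, mul_apply_eq_comp, smul_apply, map_smul, inner_smul_right,
      Complex.re_ofReal_mul, mul_assoc]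
  have hsle : ∀ b, 0 ≤ s b ∧ s b ≤ 1 + Fintype.card (F × F) * η := by
    intro b
    have hinn : ∀ {Y : K →L[ℂ] K}, 0 ≤ Y → (∀ T, Commute Y (β T)) →
        0 ≤ (⟪e b.1, Y (β (rankOne ℂ (v b.2) (v b.2)) (e b.1))⟫_ℂ).re := by
      intro Y hY hYβ
      have h1 := inner_intertwiner_apply β hYβ (e b.1) (e b.1) (v b.2) (v b.2) (e b.1) (e b.1)
      rw [inner_self_eq_norm_sq_to_K, he.1] at h1
      simp only [RCLike.ofReal_one, one_pow, one_mul] at h1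
      rw [← h1]
      exact re_inner_nonneg_of_nonneg hY _
    refine ⟨hinn hX0 hXβ, ?_⟩
    have h1 := hinn (sub_nonneg.2 hX1) h1X
    rw [sub_apply, inner_sub_right, Complex.sub_re, one_apply_eq_self] at h1
    have h2 := hΓ b b
    rw [if_pos rfl] at h2
    have h3 := (Complex.re_le_norm _).trans h2
    rw [Complex.sub_re, Complex.one_re] at h3
    have h4 : (1 : ℝ) ≤ Fintype.card (F × F) := by
      exact_mod_cast Fintype.card_pos_iff.2 ⟨b⟩
    have h5 : 1 * η ≤ Fintype.card (F × F) * η := by gcongr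
    simp only [hs]
    linarith
  have hssum : ∑ b, s b ≤ (1 + Fintype.card (F × F) * η) * Fintype.card A := by
    have h1 : ∀ a, ∑ b : F × F, (⟪e b.1, p a (β (rankOne ℂ (v b.2) (v b.2)) (e b.1))⟫_ℂ).re ≤
        1 + Fintype.card (F × F) * η := fun a =>
      sum_inner_intertwiner_le β (hp.nonneg a)
        ((Finset.single_le_sum (fun a _ => hp.nonneg a) (Finset.mem_univ a)).trans hX1) (hp.mem a)
        (hp.minimal a) (fun b : F × F => e b.1) (fun b => v b.2) hη hΓ
    calc ∑ b, s b = ∑ a, ∑ b : F × F,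
          (⟪e b.1, p a (β (rankOne ℂ (v b.2) (v b.2)) (e b.1))⟫_ℂ).re := by
          rw [Finset.sum_comm]
          refine Finset.sum_congr rfl fun b _ => ?_
          simp only [hs, hX, sum_apply, inner_sum, Complex.re_sum]
      _ ≤ ∑ a : A, (1 + Fintype.card (F × F) * η) := Finset.sum_le_sum fun a _ => h1 a
      _ = _ := by simp; ring
  have hBF : ∑ b : F × F, max (lam b.1 * lam b.2 - c) 0 ≤ B := by
    have := hB (F ×ˢ F)
    rw [Finset.sum_product, ← Finset.sum_coe_sort F] at this
    rw [Fintype.sum_prod_type]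
    refine le_of_eq_of_le (Finset.sum_congr rfl fun i _ => ?_) this
    exact Finset.sum_coe_sort F (fun j => max (lam i * lam j - c) 0)
  -- The weights s lie between 0 and 1 + |F×F|η, and their sum is at most (1 + |F×F|η)|A|. Splitting
  -- λ_iλ_j ≤ (λ_iλ_j - c)⁺ + c, use the pointwise bound for the first summand and the total for the
  -- second.
  have hfin : ∑ b : F × F, lam b.1 * lam b.2 * s b ≤
      (1 + Fintype.card (F × F) * η) * (B + c * Fintype.card A) := by
    calc ∑ b : F × F, lam b.1 * lam b.2 * s b
        ≤ ∑ b : F × F, (max (lam b.1 * lam b.2 - c) 0 * (1 + Fintype.card (F × F) * η) +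
            c * s b) := by
          refine Finset.sum_le_sum fun b _ => ?_
          have h1 := hsle b
          have h2 : lam b.1 * lam b.2 ≤ max (lam b.1 * lam b.2 - c) 0 + c := by
            linarith [le_max_left (lam b.1 * lam b.2 - c) 0]
          have h3 := mul_le_mul_of_nonneg_right h2 h1.1
          have h4 := mul_le_mul_of_nonneg_left h1.2 (le_max_right (lam b.1 * lam b.2 - c) 0)
          linarith
      _ = (∑ b : F × F, max (lam b.1 * lam b.2 - c) 0) * (1 + Fintype.card (F × F) * η) +
            c * ∑ b, s b := by
          rw [Finset.sum_add_distrib, Finset.sum_mul, Finset.mul_sum]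
      _ ≤ B * (1 + Fintype.card (F × F) * η) +
            c * ((1 + Fintype.card (F × F) * η) * Fintype.card A) := by gcongr
      _ = _ := by ring
  rw [← map_sum, ← hX, hwX]
  linarith

end Upper

/-! ### Weak operator limits along ultrafilters. -/

section WeakLimit

variable {H : Type*} [NormedAddCommGroup H] [InnerProductSpace ℂ H] [CompleteSpace H]

/-- Bounded families of operators converge in the weak operator topology along ultrafilters. -/
theorem exists_weak_limit {ι : Type*} (F : Ultrafilter ι) {X : ι → H →L[ℂ] H} {C : ℝ}
    (hX : ∀ i, ‖X i‖ ≤ C) :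
    ∃ Y : H →L[ℂ] H, ∀ x y, Tendsto (fun i => ⟪x, X i y⟫_ℂ) F (𝓝 ⟪x, Y y⟫_ℂ) := by
  have hb : ∀ x y i, ‖⟪X i x, y⟫_ℂ‖ ≤ C * ‖x‖ * ‖y‖ := fun x y i =>
    (norm_inner_le_norm _ _).trans (by gcongr; exact (X i).le_of_opNorm_le (hX i) x)
  -- Compactness of closed discs gives the limit of each matrix coefficient; the limits form a
  -- bounded sesquilinear form, which is represented by an operator.
  have hlim : ∀ x y, ∃ z, Tendsto (fun i => ⟪X i x, y⟫_ℂ) F (𝓝 z) := by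
    intro x y
    obtain ⟨z, -, hz⟩ := (isCompact_closedBall (0 : ℂ) (C * ‖x‖ * ‖y‖)).ultrafilter_le_nhds
      (F.map fun i => ⟪X i x, y⟫_ℂ) (by
        rw [le_principal_iff, Ultrafilter.mem_coe, Ultrafilter.mem_map]
        exact univ_mem' fun i => by simpa using hb x y i)
    exact ⟨z, hz⟩
  choose ℓ hℓ using hlim
  let B : H →L⋆[ℂ] H →L[ℂ] ℂ := LinearMap.mkContinuous₂
    (LinearMap.mk₂'ₛₗ (starRingEnd ℂ) (RingHom.id ℂ) ℓ
      (fun x x' y => tendsto_nhds_unique (hℓ _ _) (by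
        simpa [inner_add_left] using (hℓ x y).add (hℓ x' y)))
      (fun c x y => tendsto_nhds_unique (hℓ _ _) (by
        simpa [inner_smul_left, mul_comm] using (hℓ x y).const_mul (starRingEnd ℂ c)))
      (fun x y y' => tendsto_nhds_unique (hℓ _ _) (by
        simpa [inner_add_right] using (hℓ x y).add (hℓ x y')))
      (fun c x y => tendsto_nhds_unique (hℓ _ _) (by
        simpa [inner_smul_right] using (hℓ x y).const_mul c)))
    C (fun x y => le_of_tendsto (hℓ x y).norm (Eventually.of_forall fun i => hb x y i))
  refine ⟨continuousLinearMapOfBilin B, fun x y => ?_⟩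
  have h1 : ⟪continuousLinearMapOfBilin B y, x⟫_ℂ = ℓ y x :=
    continuousLinearMapOfBilin_apply B y x
  have h2 := (hℓ y x).star
  rw [← h1] at h2
  simpa only [RCLike.star_def, inner_conj_symm] using h2

theorem commute_of_weak_limit {ι : Type*} {F : Filter ι} [F.NeBot] {X : ι → H →L[ℂ] H}
    {Y Z : H →L[ℂ] H} (hY : ∀ x y, Tendsto (fun i => ⟪x, X i y⟫_ℂ) F (𝓝 ⟪x, Y y⟫_ℂ))
    (hZ : ∀ᶠ i in F, Commute Z (X i)) : Commute Z Y := by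
  ext y
  refine ext_inner_left ℂ fun x => ?_
  have h1 := hY (adjoint Z x) y
  have h2 := hY x (Z y)
  rw [adjoint_inner_left] at h1
  refine tendsto_nhds_unique (h1.congr' ?_) h2
  filter_upwards [hZ] with i hi
  rw [adjoint_inner_left]
  exact congrArg (fun T : H →L[ℂ] H => ⟪x, T y⟫_ℂ) hi.eq

end WeakLimit

/-! ### Order structure and endomorphisms transported from N to B(K). -/

section VonNeumann

variable {H : Type u} [NormedAddCommGroup H] [InnerProductSpace ℂ H] [CompleteSpace H]

/-- The square root commutes with everything that commutes with X, so it lies in the bicommutant N.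
-/
theorem exists_star_mul_self_of_nonneg {N : VonNeumannAlgebra H} {X : H →L[ℂ] H} (hX : X ∈ N)
    (h0 : 0 ≤ X) : ∃ Y ∈ N, X = star Y * Y := by
  refine ⟨CFC.sqrt X, ?_, ?_⟩
  · rw [← N.commutant_commutant, VonNeumannAlgebra.mem_commutant_iff]
    intro Z hZ
    have h1 : Commute X Z := (VonNeumannAlgebra.mem_commutant_iff.1 hZ X hX)
    exact (h1.cfcₙ_nnreal _).symm.eq
  · rw [(CFC.sqrt_nonneg X).isSelfAdjoint.star_eq, CFC.sqrt_mul_sqrt_self X h0]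

variable {K : Type*} [NormedAddCommGroup K] [InnerProductSpace ℂ K] [CompleteSpace K]
  {N : VonNeumannAlgebra H} (θ : N.toStarSubalgebra ≃⋆ₐ[ℂ] (K →L[ℂ] K))

/-- Positivity means being of the form y*y inside the algebra, and a *-isomorphism preserves this;
no continuity of θ enters. -/
theorem nonneg_equiv_iff (x : N.toStarSubalgebra) : 0 ≤ θ x ↔ 0 ≤ (x : H →L[ℂ] H) := by
  constructor
  · intro h
    have h1 : θ x = star (CFC.sqrt (θ x)) * CFC.sqrt (θ x) := by
      rw [(CFC.sqrt_nonneg (θ x)).isSelfAdjoint.star_eq, CFC.sqrt_mul_sqrt_self _ h]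
    have h2 : x = star (θ.symm (CFC.sqrt (θ x))) * θ.symm (CFC.sqrt (θ x)) := by
      apply EquivLike.injective θ
      rw [map_mul, map_star, StarAlgEquiv.apply_symm_apply, ← h1]
    rw [h2]
    exact star_mul_self_nonneg ((θ.symm (CFC.sqrt (θ x)) : N.toStarSubalgebra) : H →L[ℂ] H)
  · intro h
    obtain ⟨Y, hY, hXY⟩ := exists_star_mul_self_of_nonneg (N := N) x.2 h
    have h1 : x = star (⟨Y, hY⟩ : N.toStarSubalgebra) * ⟨Y, hY⟩ := Subtype.ext hXY
    rw [h1, map_mul, map_star]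
    exact star_mul_self_nonneg _

theorem le_equiv_iff (x y : N.toStarSubalgebra) :
    θ x ≤ θ y ↔ (x : H →L[ℂ] H) ≤ (y : H →L[ℂ] H) := by
  rw [← sub_nonneg, ← map_sub, nonneg_equiv_iff]
  exact sub_nonneg

/-- The representation of `B(K)` on `H` given by an identification of `N` with `B(K)`. -/
noncomputable def rep : (K →L[ℂ] K) →⋆ₐ[ℂ] (H →L[ℂ] H) :=
  N.toStarSubalgebra.subtype.comp (θ.symm : (K →L[ℂ] K) →⋆ₐ[ℂ] N.toStarSubalgebra)

theorem rep_apply (T : K →L[ℂ] K) : rep θ T = (θ.symm T : H →L[ℂ] H) := rfl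

theorem rep_equiv (x : N.toStarSubalgebra) : rep θ (θ x) = x := by
  rw [rep_apply, StarAlgEquiv.symm_apply_apply]

theorem rep_mem (T : K →L[ℂ] K) : rep θ T ∈ N := (θ.symm T).2

theorem rep_injective : Function.Injective (rep θ) :=
  Subtype.val_injective.comp (EquivLike.injective θ.symm)

/-- The endomorphism of `B(K)` corresponding to an endomorphism of `N`. -/
noncomputable def conjEndo (d : (H →L[ℂ] H) ≃⋆ₐ[ℂ] (H →L[ℂ] H)) (hd : ∀ X ∈ N, d X ∈ N) :
    (K →L[ℂ] K) →⋆ₐ[ℂ] (K →L[ℂ] K) :=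
  (θ : N.toStarSubalgebra →⋆ₐ[ℂ] (K →L[ℂ] K)).comp
    (((d : (H →L[ℂ] H) →⋆ₐ[ℂ] (H →L[ℂ] H)).comp (rep θ)).codRestrict N.toStarSubalgebra
      fun T => hd _ (rep_mem θ T))

theorem rep_conjEndo (d : (H →L[ℂ] H) ≃⋆ₐ[ℂ] (H →L[ℂ] H)) (hd : ∀ X ∈ N, d X ∈ N)
    (T : K →L[ℂ] K) : rep θ (conjEndo θ d hd T) = d (rep θ T) :=
  rep_equiv θ ⟨d (rep θ T), hd _ (rep_mem θ T)⟩

end VonNeumann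

/-! ### Convergence of the orbits of a pure semigroup to the invariant state. -/

section Absorption

variable {H : Type u} [NormedAddCommGroup H] [InnerProductSpace ℂ H] [CompleteSpace H]
  {K : Type*} [NormedAddCommGroup K] [InnerProductSpace ℂ K] [CompleteSpace K]
  {N : VonNeumannAlgebra H} (θ : N.toStarSubalgebra ≃⋆ₐ[ℂ] (K →L[ℂ] K))

/-- A one-parameter group of automorphisms which for positive times acts on `N` as a pure
semigroup of endomorphisms. -/
structure IsPureSemigroup (N : VonNeumannAlgebra H)
    (δ : ℝ → (H →L[ℂ] H) ≃⋆ₐ[ℂ] (H →L[ℂ] H)) : Prop where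
  add : ∀ s t X, δ (s + t) X = δ s (δ t X)
  norm : ∀ t X, ‖δ t X‖ = ‖X‖
  mem : ∀ t, 0 ≤ t → ∀ X ∈ N, δ t X ∈ N
  -- The premise says that Y lies in δ_t(N) for every t ≥ 0, so the tail intersection consists of
  -- scalars.
  pure : ∀ Y, (∀ t, 0 ≤ t → δ (-t) Y ∈ N) → ∃ c : ℂ, Y = c • 1

variable {δ : ℝ → (H →L[ℂ] H) ≃⋆ₐ[ℂ] (H →L[ℂ] H)}

theorem IsPureSemigroup.zero (hδ : IsPureSemigroup N δ) (X : H →L[ℂ] H) : δ 0 X = X := by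
  apply EquivLike.injective (δ 0)
  rw [← hδ.add, add_zero]

theorem IsPureSemigroup.neg_apply (hδ : IsPureSemigroup N δ) (t : ℝ) (X : H →L[ℂ] H) :
    δ (-t) (δ t X) = X := by
  rw [← hδ.add, neg_add_cancel, hδ.zero]

/-- Weak limit points at infinity of the orbits of a pure semigroup are scalars. -/
theorem IsPureSemigroup.exists_scalar_limit (hδ : IsPureSemigroup N δ) {X : H →L[ℂ] H}
    (hX : X ∈ N) {F : Ultrafilter ℕ} (hF : (F : Filter ℕ) ≤ atTop) :
    ∃ c : ℂ, ∀ x y, Tendsto (fun n : ℕ => ⟪x, δ n X y⟫_ℂ) F (𝓝 (c * ⟪x, y⟫_ℂ)) := by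
  obtain ⟨Y, hY⟩ := exists_weak_limit F (X := fun n : ℕ => δ n X) (C := ‖X‖)
    fun n => (hδ.norm n X).le
  obtain ⟨c, rfl⟩ := hδ.pure Y (by
    intro s hs
    rw [← N.commutant_commutant, VonNeumannAlgebra.mem_commutant_iff]
    intro Z hZ
    rw [VonNeumannAlgebra.mem_commutant_iff] at hZ
    -- For n ≥ s the operator δ_n(X) lies in δ_s(N) and commutes with δ_s(Z) for Z ∈ N'. This
    -- survives the weak limit, so Y ∈ δ_s(N).
    have h1 : Commute (δ s Z) Y := by
      refine commute_of_weak_limit hY ?_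
      filter_upwards [hF (eventually_ge_atTop ⌈s⌉₊)] with n hn
      have hsn : s ≤ n := Nat.ceil_le.1 hn
      have h2 := congrArg (δ s) (hZ _ (hδ.mem (n - s) (sub_nonneg.2 hsn) X hX))
      rw [map_mul, map_mul, ← hδ.add, add_sub_cancel] at h2
      exact h2.symm
    have h3 := congrArg (δ (-s)) h1.eq
    rwa [map_mul, map_mul, hδ.neg_apply] at h3)
  exact ⟨c, by simpa [inner_smul_right] using hY⟩

variable {J : Type*} {lam : J → ℝ} {e : J → K}

/-- A normal invariant state of a pure semigroup is absorbing: in the weak operator topology the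
orbits converge to the values of the state. -/
theorem IsPureSemigroup.tendsto_inner (hδ : IsPureSemigroup N δ) (hlam : ∀ j, 0 < lam j)
    (he : Orthonormal ℂ e) (hsum : HasSum lam 1) {Ω : (K →L[ℂ] K) → ℂ}
    (hΩ : ∀ T, HasSum (fun j => (lam j : ℂ) * ⟪e j, T (e j)⟫_ℂ) (Ω T))
    (hinv : ∀ (n : ℕ) T, Ω (conjEndo θ (δ n) (hδ.mem n n.cast_nonneg) T) = Ω T)
    (T : K →L[ℂ] K) (u v : K) :
    Tendsto (fun n : ℕ => ⟪u, conjEndo θ (δ n) (hδ.mem n n.cast_nonneg) T v⟫_ℂ) atTop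
      (𝓝 (Ω T * ⟪u, v⟫_ℂ)) := by
  -- Along each ultrafilter a limit exists by compactness; the claim is that it is always the same.
  rw [tendsto_iff_ultrafilter]
  intro F hF
  obtain ⟨c, hc⟩ := hδ.exists_scalar_limit (rep_mem θ T) hF
  have hJ : Nonempty J := by
    by_contra h
    rw [not_nonempty_iff] at h
    exact zero_ne_one (hasSum_empty.unique hsum)
  obtain ⟨x, hx⟩ : ∃ x, rep θ (rankOne ℂ (e hJ.some) (e hJ.some)) x ≠ 0 := by
    by_contra! h
    have h1 : rep θ (rankOne ℂ (e hJ.some) (e hJ.some)) = 0 := ContinuousLinearMap.ext h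
    rw [map_eq_zero_iff _ (rep_injective θ), rankOne_eq_zero] at h1
    have := he.1 hJ.some
    simp_all
  set g := intertwiner (rep θ) x (e hJ.some) with hg
  set κ := ⟪x, rep θ (rankOne ℂ (e hJ.some) (e hJ.some)) x⟫_ℂ with hκ
  have hκ0 : κ ≠ 0 := by
    have h1 : rankOne ℂ (e hJ.some) (e hJ.some) =
        star (rankOne ℂ (e hJ.some) (e hJ.some)) * rankOne ℂ (e hJ.some) (e hJ.some) := by
      rw [star_rankOne, rankOne_mul_rankOne, inner_self_eq_norm_sq_to_K, he.1]
      simp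
    rw [hκ, h1, map_mul, mul_apply_eq_comp, ← star_star (rankOne ℂ (e hJ.some) (e hJ.some)),
      ← inner_map_left, star_star]
    exact inner_self_ne_zero.2 hx
  -- The scalar limit is known on H; the intertwiner g, which is √κ times an isometry, carries
  -- matrix coefficients on K to matrix coefficients on H.
  have hlim : ∀ u v, Tendsto (fun n : ℕ => ⟪u, conjEndo θ (δ n) (hδ.mem n n.cast_nonneg) T v⟫_ℂ)
      F (𝓝 (c * ⟪u, v⟫_ℂ)) := by
    intro u v
    have h1 := (hc (g u) (g v)).div_const κ
    have h2 : ∀ S : K →L[ℂ] K, ⟪g u, rep θ S (g v)⟫_ℂ = ⟪u, S v⟫_ℂ * κ := by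
      intro S
      rw [hg, map_apply_intertwiner, inner_intertwiner]
    have h3 : ⟪g u, g v⟫_ℂ = ⟪u, v⟫_ℂ * κ := by rw [hg, inner_intertwiner]
    simp only [← rep_conjEndo θ _ (hδ.mem _ (Nat.cast_nonneg _)), h2, h3, ← mul_assoc,
      mul_div_cancel_right₀ _ hκ0] at h1
    exact h1
  -- Apply the state to the orbit: by invariance the value is constantly Ω T, and dominated
  -- convergence over the eigenvectors sends it to c.
  have hcΩ : c = Ω T := by
    have h1 : Tendsto (fun n : ℕ => ∑' j, (lam j : ℂ) *
        ⟪e j, conjEndo θ (δ n) (hδ.mem n n.cast_nonneg) T (e j)⟫_ℂ) F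
        (𝓝 (∑' j, (lam j : ℂ) * (c * ⟪e j, e j⟫_ℂ))) := by
      refine tendsto_tsum_of_dominated_convergence (bound := fun j => lam j * ‖T‖)
        (hsum.summable.mul_right _) (fun j => (hlim (e j) (e j)).const_mul _)
        (Eventually.of_forall fun n j => ?_)
      rw [norm_mul, Complex.norm_real, Real.norm_of_nonneg (hlam j).le]
      refine mul_le_mul_of_nonneg_left ?_ (hlam j).le
      refine (norm_inner_le_norm _ _).trans ?_
      have h2 := NonUnitalStarAlgHom.norm_apply_le (conjEndo θ (δ n) (hδ.mem n n.cast_nonneg)) T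
      have h3 := (conjEndo θ (δ n) (hδ.mem n n.cast_nonneg) T).le_opNorm (e j)
      rw [he.1, mul_one] at h3
      rw [he.1, one_mul]
      exact h3.trans h2
    simp only [(hΩ _).tsum_eq, hinv, inner_self_eq_norm_sq_to_K, he.1] at h1
    have h4 : HasSum (fun j => (lam j : ℂ) * c) (1 * c) := by
      have := (Complex.hasSum_ofReal.2 hsum).mul_right c
      simpa using this
    have h5 := tendsto_nhds_unique h1 tendsto_const_nhds
    simp only [RCLike.ofReal_one, one_pow, mul_one, h4.tsum_eq, one_mul] at h5
    exact h5
  rw [← hcΩ]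
  exact hlim u v

end Absorption

/-! ### Asymptotic bounds for the state on the relative commutants. -/

section OneSided

variable {H : Type u} [NormedAddCommGroup H] [InnerProductSpace ℂ H] [CompleteSpace H]
  {K : Type*} [NormedAddCommGroup K] [InnerProductSpace ℂ K] [CompleteSpace K]
  {N : VonNeumannAlgebra H} (θ : N.toStarSubalgebra ≃⋆ₐ[ℂ] (K →L[ℂ] K))

/-- The relative commutant in `N` of the image of `N` under `d`. -/
def relCommutantIn (N : VonNeumannAlgebra H) (d : (H →L[ℂ] H) ≃⋆ₐ[ℂ] (H →L[ℂ] H)) :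
    Set (H →L[ℂ] H) :=
  {X | X ∈ N ∧ ∀ Y ∈ N, Commute X (d Y)}

theorem equiv_mem_relCommutant_iff (d : (H →L[ℂ] H) ≃⋆ₐ[ℂ] (H →L[ℂ] H)) (hd : ∀ X ∈ N, d X ∈ N)
    (x : N.toStarSubalgebra) :
    θ x ∈ relCommutant (conjEndo θ d hd) ↔ (x : H →L[ℂ] H) ∈ relCommutantIn N d := by
  have h : ∀ T, Commute (θ x) (conjEndo θ d hd T) ↔ Commute (x : H →L[ℂ] H) (d (rep θ T)) := by
    intro T
    rw [← rep_conjEndo θ d hd, ← rep_equiv θ x]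
    exact (commute_map_iff (f := rep θ) (rep_injective θ)).symm
  constructor
  · intro hx
    refine ⟨x.2, fun Y hY => ?_⟩
    have := (h (θ ⟨Y, hY⟩)).1 (hx _)
    rwa [rep_equiv] at this
  · intro hx T
    exact (h T).2 (hx.2 _ (rep_mem θ T))

/-- Minimal families can thus be treated as operators on H, the only space that the two sides have
in common. -/
theorem isMinimalFamily_equiv_iff {A : Type*} [Fintype A] (d : (H →L[ℂ] H) ≃⋆ₐ[ℂ] (H →L[ℂ] H))
    (hd : ∀ X ∈ N, d X ∈ N) (x : A → N.toStarSubalgebra) :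
    IsMinimalFamily (relCommutant (conjEndo θ d hd)) (fun a => θ (x a)) ↔
      IsMinimalFamily (relCommutantIn N d) (fun a => (x a : H →L[ℂ] H)) := by
  have hsum : ∑ a, θ (x a) ≤ 1 ↔ ∑ a, (x a : H →L[ℂ] H) ≤ 1 := by
    have := le_equiv_iff θ (∑ a, x a) 1
    rw [map_sum, map_one] at this
    simpa using this
  constructor
  · intro h
    refine ⟨fun a => (equiv_mem_relCommutant_iff θ d hd _).1 (h.mem a),
      fun a => (nonneg_equiv_iff θ _).1 (h.nonneg a), hsum.1 h.sum_le_one, fun a Y hY => ?_⟩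
    obtain ⟨z, hz⟩ := h.minimal a (θ ⟨Y, hY.1⟩) ((equiv_mem_relCommutant_iff θ d hd _).2 hY)
    refine ⟨z, ?_⟩
    have := congrArg (rep θ) hz
    simpa only [map_mul, map_smul, rep_equiv] using this
  · intro h
    refine ⟨fun a => (equiv_mem_relCommutant_iff θ d hd _).2 (h.mem a),
      fun a => (nonneg_equiv_iff θ _).2 (h.nonneg a), hsum.2 h.sum_le_one, fun a Y hY => ?_⟩
    obtain ⟨y, rfl⟩ := EquivLike.surjective θ Y
    obtain ⟨z, hz⟩ := h.minimal a y ((equiv_mem_relCommutant_iff θ d hd _).1 hY)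
    refine ⟨z, rep_injective θ ?_⟩
    simpa only [map_mul, map_smul, rep_equiv] using hz

/-- The real part of a state, as a functional on `B(K)`. -/
noncomputable def State.reFunctional (ω : State N.toStarSubalgebra) : (K →L[ℂ] K) →ₗ[ℝ] ℝ where
  toFun T := (ω.toLinearMap (θ.symm T)).re
  map_add' S T := by simp
  map_smul' r T := by
    rw [← Complex.coe_smul, map_smul, map_smul, smul_eq_mul, Complex.re_ofReal_mul]
    rfl

variable {δ : ℝ → (H →L[ℂ] H) ≃⋆ₐ[ℂ] (H →L[ℂ] H)} {J : Type*} {lam : J → ℝ} {e : J → K}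
  {ω : State N.toStarSubalgebra}

/-- The state `ω` is given, under the identification `θ` of `N` with `B(K)`, by a density operator
with eigenvectors `e j` for the strictly positive eigenvalues `lam j`. -/
structure IsDiagonalized (ω : State N.toStarSubalgebra) (lam : J → ℝ) (e : J → K) : Prop where
  pos : ∀ j, 0 < lam j
  orthonormal : Orthonormal ℂ e
  hasSum : ∀ x : N.toStarSubalgebra,
    HasSum (fun j => (lam j : ℂ) * ⟪e j, θ x (e j)⟫_ℂ) (ω.toLinearMap x)

variable {θ}

theorem IsDiagonalized.hasSum_symm (hω : IsDiagonalized θ ω lam e) (T : K →L[ℂ] K) :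
    HasSum (fun j => (lam j : ℂ) * ⟪e j, T (e j)⟫_ℂ) (ω.toLinearMap (θ.symm T)) := by
  simpa using hω.hasSum (θ.symm T)

theorem IsDiagonalized.hasSum_re (hω : IsDiagonalized θ ω lam e) (T : K →L[ℂ] K) :
    HasSum (fun j => lam j * (⟪e j, T (e j)⟫_ℂ).re) (ω.reFunctional θ T) := by
  have := Complex.hasSum_re (hω.hasSum_symm T)
  simp only [Complex.re_ofReal_mul] at this
  exact this

theorem IsDiagonalized.hasSum_one (hω : IsDiagonalized θ ω lam e) : HasSum lam 1 := by
  have h := hω.hasSum_re 1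
  have h1 : ω.reFunctional θ (1 : K →L[ℂ] K) = 1 := by
    change (ω.toLinearMap (θ.symm 1)).re = 1
    rw [map_one, ω.map_one', Complex.one_re]
  rw [h1] at h
  simpa [inner_self_eq_norm_sq_to_K, hω.orthonormal.1] using h

/-- The Gram matrices of the normalized intertwiners converge to the identity. -/
theorem IsPureSemigroup.eventually_gram_le [DecidableEq J] (hδ : IsPureSemigroup N δ)
    (hω : IsDiagonalized θ ω lam e)
    (hinv : ∀ t, 0 ≤ t → ∀ X (hX : X ∈ N) (hX' : δ t X ∈ N), ω.val (δ t X) hX' = ω.val X hX)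
    {A : Type*} [Finite A] [DecidableEq A] {f : A → J × J} (hf : Function.Injective f) {η : ℝ}
    (hη : 0 < η) :
    ∀ᶠ n : ℕ in atTop, ∀ a b, ‖⟪e (f a).1, conjEndo θ (δ n) (hδ.mem n n.cast_nonneg)
      (rankOne ℂ (((√(lam (f a).2))⁻¹ : ℝ) • e (f a).2) (((√(lam (f b).2))⁻¹ : ℝ) • e (f b).2))
      (e (f b).1)⟫_ℂ - if a = b then 1 else 0‖ ≤ η := by
  rw [eventually_all]
  intro a
  rw [eventually_all]
  intro b
  have h1 := hδ.tendsto_inner θ (Ω := fun T => ω.toLinearMap (θ.symm T)) hω.pos hω.orthonormal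
    hω.hasSum_one hω.hasSum_symm (by
      intro n T
      have h2 := hinv n n.cast_nonneg (rep θ T) (rep_mem θ T)
        (hδ.mem n n.cast_nonneg _ (rep_mem θ T))
      refine Eq.trans (congrArg ω.toLinearMap (Subtype.ext ?_)) h2
      exact rep_conjEndo θ _ _ T)
    (rankOne ℂ (((√(lam (f a).2))⁻¹ : ℝ) • e (f a).2) (((√(lam (f b).2))⁻¹ : ℝ) • e (f b).2))
    (e (f a).1) (e (f b).1)
  -- The factors 1/√λ make the vectors v_j orthonormal for the state: ω(|v_j⟩⟨v_k|) = δ_jk.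
  have h3 : ω.toLinearMap (θ.symm (rankOne ℂ (((√(lam (f a).2))⁻¹ : ℝ) • e (f a).2)
      (((√(lam (f b).2))⁻¹ : ℝ) • e (f b).2))) = if (f a).2 = (f b).2 then 1 else 0 := by
    refine (hω.hasSum_symm _).unique ?_
    have h4 : ∀ j, (lam j : ℂ) * ⟪e j, rankOne ℂ (((√(lam (f a).2))⁻¹ : ℝ) • e (f a).2)
        (((√(lam (f b).2))⁻¹ : ℝ) • e (f b).2) (e j)⟫_ℂ =
        if j = (f a).2 then (if (f a).2 = (f b).2 then 1 else 0) else 0 := by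
      intro j
      rw [rankOne_apply]
      simp only [← Complex.coe_smul, inner_smul_left, inner_smul_right,
        orthonormal_iff_ite.1 hω.orthonormal]
      by_cases hj : j = (f a).2
      · subst hj
        by_cases hab : (f a).2 = (f b).2
        · rw [← hab]
          have h0 : (√(lam (f a).2) : ℂ) ≠ 0 := by
            exact_mod_cast (Real.sqrt_pos.2 (hω.pos _)).ne'
          have h5 : (lam (f a).2 : ℂ) = (√(lam (f a).2) : ℂ) * (√(lam (f a).2) : ℂ) := by
            rw [← Complex.ofReal_mul, Real.mul_self_sqrt (hω.pos _).le]
          simp only [if_true, Complex.conj_ofReal, Complex.ofReal_inv, map_inv₀]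
          rw [h5]
          field_simp
        · rw [if_neg (Ne.symm hab), if_neg hab]
          simp
      · rw [if_neg hj, if_neg hj]
        simp
    simp only [h4]
    exact hasSum_ite_eq _ _
  rw [h3, orthonormal_iff_ite.1 hω.orthonormal] at h1
  have h6 : ((if (f a).2 = (f b).2 then 1 else 0) * if (f a).1 = (f b).1 then 1 else 0 : ℂ) =
      if a = b then 1 else 0 := by
    by_cases hab : a = b
    · simp [hab]
    · have : ¬ ((f a).1 = (f b).1 ∧ (f a).2 = (f b).2) := fun h => hab (hf (Prod.ext h.1 h.2))
      rw [if_neg hab]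
      by_cases h : (f a).1 = (f b).1
      · rw [if_neg fun h' => this ⟨h, h'⟩, zero_mul]
      · rw [if_neg h, mul_zero]
  rw [h6] at h1
  have h7 := (h1.sub_const (if a = b then 1 else 0 : ℂ)).norm
  rw [sub_self, norm_zero] at h7
  filter_upwards [h7.eventually (gt_mem_nhds hη)] with n hn
  exact hn.le

/-- Lower bound: for large times the relative commutant contains minimal families on which the
state takes values close to products of eigenvalues. -/
theorem IsPureSemigroup.eventually_exists_isMinimalFamily (hδ : IsPureSemigroup N δ)
    (hω : IsDiagonalized θ ω lam e)
    (hinv : ∀ t, 0 ≤ t → ∀ X (hX : X ∈ N) (hX' : δ t X ∈ N), ω.val (δ t X) hX' = ω.val X hX)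
    {A : Type*} [Fintype A] {f : A → J × J} (hf : Function.Injective f) {ε : ℝ} (hε : 0 < ε) :
    ∀ᶠ n : ℕ in atTop, ∃ p : A → H →L[ℂ] H, IsMinimalFamily (relCommutantIn N (δ n)) p ∧
      ∀ a (ha : p a ∈ N), lam (f a).1 * lam (f a).2 - ε ≤ (ω.val (p a) ha).re := by
  classical
  -- The lower bound at precision η tends to λ_iλ_j as η ↓ 0; A is finite, so one η serves all
  -- indices.
  have hlim : ∀ a, Tendsto (fun η : ℝ => (1 + Fintype.card A * η)⁻¹ *
      (lam (f a).1 * lam (f a).2 * (1 - η) ^ 2)) (𝓝[>] 0) (𝓝 (lam (f a).1 * lam (f a).2)) := by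
    intro a
    have h : ContinuousAt (fun η : ℝ => (1 + Fintype.card A * η)⁻¹ *
      (lam (f a).1 * lam (f a).2 * (1 - η) ^ 2)) 0 := by
      refine ContinuousAt.mul (ContinuousAt.inv₀ (by fun_prop) (by simp)) (by fun_prop)
    have h2 := h.tendsto.mono_left (nhdsWithin_le_nhds (s := Set.Ioi 0))
    simpa using h2
  obtain ⟨η, ⟨hη1, hη⟩, hη0⟩ := (((eventually_all.2 fun a => (hlim a).eventually
    (lt_mem_nhds (sub_lt_self _ hε))).and
    (nhdsWithin_le_nhds (gt_mem_nhds (zero_lt_one' ℝ)))).and self_mem_nhdsWithin).exists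
  have hη0 : 0 < η := hη0
  filter_upwards [hδ.eventually_gram_le hω hinv hf hη0] with n hn
  set β := conjEndo θ (δ n) (hδ.mem n n.cast_nonneg) with hβ
  set p := fun a => ((1 + Fintype.card A * η)⁻¹ : ℝ) •
    (intertwiner β (e (f a).1) (((√(lam (f a).2))⁻¹ : ℝ) • e (f a).2) ∘L
      adjoint (intertwiner β (e (f a).1) (((√(lam (f a).2))⁻¹ : ℝ) • e (f a).2))) with hp
  have hmin : IsMinimalFamily (relCommutant β) p :=
    isMinimalFamily_intertwiner β (fun a => e (f a).1)
      (fun a => ((√(lam (f a).2))⁻¹ : ℝ) • e (f a).2) hη0.le hn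
  refine ⟨fun a => θ.symm (p a), (isMinimalFamily_equiv_iff θ (δ n) (hδ.mem n n.cast_nonneg)
    fun a => θ.symm (p a)).1 (by simpa using hmin), fun a _ => ?_⟩
  change _ ≤ ω.reFunctional θ (p a)
  have h1 := le_apply_intertwiner_comp_adjoint β hω.pos hω.orthonormal hω.hasSum_re
    (f a).1 (f a).2 hη.le (by simpa using hn a a)
  rw [hp, map_smul, smul_eq_mul]
  refine (hη1 a).le.trans ?_
  have h2 : 0 < (1 + Fintype.card A * η) := by positivity
  exact mul_le_mul_of_nonneg_left h1 (by positivity)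

/-- Upper bound: for large times, the sum of the values of the state on a minimal family in the
relative commutant is controlled by the products of eigenvalues. -/
theorem IsPureSemigroup.eventually_sum_le (hδ : IsPureSemigroup N δ)
    (hω : IsDiagonalized θ ω lam e)
    (hinv : ∀ t, 0 ≤ t → ∀ X (hX : X ∈ N) (hX' : δ t X ∈ N), ω.val (δ t X) hX' = ω.val X hX)
    (A : Type*) [Fintype A] {c B : ℝ} (hc : 0 ≤ c)
    (hB : ∀ S : Finset (J × J), ∑ b ∈ S, max (lam b.1 * lam b.2 - c) 0 ≤ B)
    {ε : ℝ} (hε : 0 < ε) :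
    ∀ᶠ n : ℕ in atTop, ∀ p : A → H →L[ℂ] H, IsMinimalFamily (relCommutantIn N (δ n)) p →
      ∀ h : ∀ a, p a ∈ N, ∑ a, (ω.val (p a) (h a)).re ≤ B + c * Fintype.card A + ε := by
  classical
  -- Error budget: the tail ε/4 outside F enters twice, and η is chosen so that the Gram error costs
  -- at most ε/2.
  obtain ⟨F, hF⟩ : ∃ F : Finset J, 1 - ε / 4 ≤ ∑ j ∈ F, lam j := by
    obtain ⟨F, hF⟩ := (hω.hasSum_one.eventually
      (lt_mem_nhds (show 1 - ε / 4 < 1 by linarith))).exists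
    exact ⟨F, hF.le⟩
  have hlim : Tendsto (fun η : ℝ => (1 + Fintype.card (F × F) * η) *
      (B + c * Fintype.card A)) (𝓝[>] 0) (𝓝 (B + c * Fintype.card A)) := by
    have h : Continuous (fun η : ℝ => (1 + Fintype.card (F × F) * η) *
      (B + c * Fintype.card A)) := by fun_prop
    simpa using h.continuousAt.tendsto.mono_left (nhdsWithin_le_nhds (a := (0 : ℝ)) (s := Set.Ioi 0))
  obtain ⟨η, hη, hη0⟩ := ((hlim.eventually (gt_mem_nhds (show B + c * Fintype.card A <
    B + c * Fintype.card A + ε / 2 by linarith))).and self_mem_nhdsWithin).exists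
  have hη0 : 0 < η := hη0
  filter_upwards [hδ.eventually_gram_le hω hinv (A := F × F)
    (f := fun b => ((b.1 : J), (b.2 : J))) (fun b b' h => by
      simp only [Prod.mk.injEq] at h
      exact Prod.ext (Subtype.ext h.1) (Subtype.ext h.2)) hη0] with n hn p hp h
  have hp' := (isMinimalFamily_equiv_iff θ (δ n) (hδ.mem n n.cast_nonneg)
    fun a => (⟨p a, h a⟩ : N.toStarSubalgebra)).2 hp
  have h1 := sum_apply_isMinimalFamily_le _ hp' hω.pos hω.orthonormal hω.hasSum_re hω.hasSum_one
    (by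
      intro T
      have h2 := hinv n n.cast_nonneg (rep θ T) (rep_mem θ T)
        (hδ.mem n n.cast_nonneg _ (rep_mem θ T))
      refine congrArg Complex.re (Eq.trans (congrArg ω.toLinearMap (Subtype.ext ?_)) h2)
      exact rep_conjEndo θ _ _ T) F hF hη0.le hn hc hB
  have h3 : ∀ a, ω.reFunctional θ (θ (⟨p a, h a⟩ : N.toStarSubalgebra)) =
      (ω.val (p a) (h a)).re := by
    intro a
    change (ω.toLinearMap (θ.symm (θ _))).re = _
    rw [StarAlgEquiv.symm_apply_apply]
    rfl
  simp only [h3] at h1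
  linarith

end OneSided

/-! ### Comparing the eigenvalue lists of two semigroups. -/

section Comparison

variable {H : Type u} [NormedAddCommGroup H] [InnerProductSpace ℂ H] [CompleteSpace H]

theorem map_nonneg_of_starAlgEquiv (α : (H →L[ℂ] H) ≃⋆ₐ[ℂ] (H →L[ℂ] H)) {X : H →L[ℂ] H}
    (hX : 0 ≤ X) : 0 ≤ α X := by
  have h1 : X = star (CFC.sqrt X) * CFC.sqrt X := by
    rw [(CFC.sqrt_nonneg X).isSelfAdjoint.star_eq, CFC.sqrt_mul_sqrt_self _ hX]
  have h2 : α (star (CFC.sqrt X)) = star (α (CFC.sqrt X)) := α.map_star' _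
  rw [h1, map_mul, h2]
  exact star_mul_self_nonneg _

theorem IsMinimalFamily.map {A : Type*} [Fintype A] {C₁ C₂ : Set (H →L[ℂ] H)}
    {p : A → H →L[ℂ] H} (hp : IsMinimalFamily C₁ p) (α : (H →L[ℂ] H) ≃⋆ₐ[ℂ] (H →L[ℂ] H))
    (hα : ∀ X, X ∈ C₁ ↔ α X ∈ C₂) : IsMinimalFamily C₂ fun a => α (p a) where
  mem a := (hα _).1 (hp.mem a)
  nonneg a := map_nonneg_of_starAlgEquiv α (hp.nonneg a)
  sum_le_one := by
    have := map_nonneg_of_starAlgEquiv α (sub_nonneg.2 hp.sum_le_one)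
    rwa [map_sub, map_sum, map_one, sub_nonneg] at this
  minimal a Y hY := by
    obtain ⟨X, rfl⟩ := EquivLike.surjective α Y
    obtain ⟨z, hz⟩ := hp.minimal a X ((hα _).2 hY)
    exact ⟨z, by rw [← map_mul, ← map_mul, hz, map_smul]⟩

/-- A pair with an index at least k has product at most Λ 0 * Λ k, so its positive part vanishes.
This turns the bound over all finite sets of pairs into a sum over a fixed square. -/
theorem sum_pos_part_le {Λ : ℕ → ℝ} (hΛ : Antitone Λ) (h0 : ∀ n, 0 ≤ Λ n) (k : ℕ)
    (S : Finset ({n // 0 < Λ n} × {n // 0 < Λ n})) :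
    ∑ b ∈ S, max (Λ b.1 * Λ b.2 - Λ 0 * Λ k) 0 ≤
      ∑ b ∈ Finset.range k ×ˢ Finset.range k, max (Λ b.1 * Λ b.2 - Λ 0 * Λ k) 0 := by
  classical
  set g : ℕ × ℕ → ℝ := fun b => max (Λ b.1 * Λ b.2 - Λ 0 * Λ k) 0 with hg
  have hinj : Function.Injective
      fun b : {n // 0 < Λ n} × {n // 0 < Λ n} => ((b.1 : ℕ), (b.2 : ℕ)) := fun b b' h => by
    simp only [Prod.mk.injEq] at h
    exact Prod.ext (Subtype.ext h.1) (Subtype.ext h.2)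
  have h1 : ∑ b ∈ S, max (Λ b.1 * Λ b.2 - Λ 0 * Λ k) 0 = ∑ b ∈ S.map ⟨_, hinj⟩, g b := by
    rw [Finset.sum_map]
    rfl
  rw [h1, ← Finset.sum_filter_ne_zero]
  refine Finset.sum_le_sum_of_subset_of_nonneg (fun b hb => ?_) fun b _ _ => le_max_right _ _
  rw [Finset.mem_filter] at hb
  by_contra hbR
  refine hb.2 (max_eq_right (sub_nonpos.2 ?_))
  simp only [Finset.mem_product, Finset.mem_range, not_and_or, not_lt] at hbR
  rcases hbR with h | h
  · rw [mul_comm (Λ 0)]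
    exact mul_le_mul (hΛ h) (hΛ (Nat.zero_le _)) (h0 _) (h0 _)
  · exact mul_le_mul (hΛ (Nat.zero_le _)) (hΛ h) (h0 _) (h0 _)

variable {K₁ : Type*} [NormedAddCommGroup K₁] [InnerProductSpace ℂ K₁] [CompleteSpace K₁]
  {N₁ : VonNeumannAlgebra H} {θ₁ : N₁.toStarSubalgebra ≃⋆ₐ[ℂ] (K₁ →L[ℂ] K₁)}
  {δ₁ : ℝ → (H →L[ℂ] H) ≃⋆ₐ[ℂ] (H →L[ℂ] H)} {ω₁ : State N₁.toStarSubalgebra}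
  {K₂ : Type*} [NormedAddCommGroup K₂] [InnerProductSpace ℂ K₂] [CompleteSpace K₂]
  {N₂ : VonNeumannAlgebra H} {θ₂ : N₂.toStarSubalgebra ≃⋆ₐ[ℂ] (K₂ →L[ℂ] K₂)}
  {δ₂ : ℝ → (H →L[ℂ] H) ≃⋆ₐ[ℂ] (H →L[ℂ] H)} {ω₂ : State N₂.toStarSubalgebra}
  {Λ₁ Λ₂ : ℕ → ℝ} {e₁ : {n // 0 < Λ₁ n} → K₁} {e₂ : {n // 0 < Λ₂ n} → K₂}

/-- If two pure semigroups with normal invariant states have isomorphic relative commutants, then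
the eigenvalue lists of the states agree: the first difference cannot be in favour of one side. -/
theorem eigenvalue_le_of_forall_lt_eq
    (hδ₁ : IsPureSemigroup N₁ δ₁) (hδ₂ : IsPureSemigroup N₂ δ₂)
    (hinv₁ : ∀ t, 0 ≤ t → ∀ X (hX : X ∈ N₁) (hX' : δ₁ t X ∈ N₁),
      ω₁.val (δ₁ t X) hX' = ω₁.val X hX)
    (hinv₂ : ∀ t, 0 ≤ t → ∀ X (hX : X ∈ N₂) (hX' : δ₂ t X ∈ N₂),
      ω₂.val (δ₂ t X) hX' = ω₂.val X hX)
    (hω₁ : IsDiagonalized θ₁ ω₁ (fun n : {n // 0 < Λ₁ n} => Λ₁ n) e₁)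
    (hω₂ : IsDiagonalized θ₂ ω₂ (fun n : {n // 0 < Λ₂ n} => Λ₂ n) e₂)
    (hΛ₁ : Antitone Λ₁) (hΛ₁0 : ∀ n, 0 ≤ Λ₁ n) (hΛ₂ : Antitone Λ₂) (hΛ₂0 : ∀ n, 0 ≤ Λ₂ n)
    (α : ℕ → (H →L[ℂ] H) ≃⋆ₐ[ℂ] (H →L[ℂ] H))
    (hα : ∀ (n : ℕ) X, X ∈ relCommutantIn N₁ (δ₁ n) ↔ α n X ∈ relCommutantIn N₂ (δ₂ n))
    (hαω : ∀ (n : ℕ) X (h₁ : X ∈ relCommutantIn N₁ (δ₁ n))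
      (h₂ : α n X ∈ relCommutantIn N₂ (δ₂ n)), ω₂.val (α n X) h₂.1 = ω₁.val X h₁.1)
    (k : ℕ) (hk : ∀ i < k, Λ₁ i = Λ₂ i) : Λ₁ k ≤ Λ₂ k := by
  classical
  by_contra! hlt
  -- At this threshold only pairs with both indices below k matter on side 2, and there the two
  -- lists agree.
  set c := Λ₂ 0 * Λ₂ k with hc
  have hc0 : 0 ≤ c := mul_nonneg (hΛ₂0 _) (hΛ₂0 _)
  have hck : c < Λ₁ 0 * Λ₁ k := by
    have h1 : 0 < Λ₁ k := (hΛ₂0 k).trans_lt hlt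
    have h2 : 0 < Λ₁ 0 := h1.trans_le (hΛ₁ (Nat.zero_le k))
    have h3 : Λ₂ 0 ≤ Λ₁ 0 := by
      rcases Nat.eq_zero_or_pos k with rfl | h
      · exact hlt.le
      · exact (hk 0 h).ge
    calc c ≤ Λ₁ 0 * Λ₂ k := mul_le_mul_of_nonneg_right h3 (hΛ₂0 k)
      _ < Λ₁ 0 * Λ₁ k := mul_lt_mul_of_pos_left hlt h2
  set R := Finset.range k ×ˢ Finset.range k with hR
  -- All pairs of the square whose product exceeds c, together with the one extra pair (0,k) that
  -- exceeds c on side 1 only.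
  set P : Finset (ℕ × ℕ) := insert (0, k) (R.filter fun b => c < Λ₁ b.1 * Λ₁ b.2) with hP
  have hPc : ∀ b ∈ P, c < Λ₁ b.1 * Λ₁ b.2 := by
    intro b hb
    rcases Finset.mem_insert.1 hb with rfl | hb
    · exact hck
    · exact (Finset.mem_filter.1 hb).2
  have hP1 : ∀ b : P, 0 < Λ₁ b.1.1 := fun b => (hΛ₁0 _).lt_of_ne fun h => by
    have := hPc b b.2
    rw [← h, zero_mul] at this
    exact absurd this hc0.not_gt
  have hP2 : ∀ b : P, 0 < Λ₁ b.1.2 := fun b => (hΛ₁0 _).lt_of_ne fun h => by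
    have := hPc b b.2
    rw [← h, mul_zero] at this
    exact absurd this hc0.not_gt
  set f : P → {n // 0 < Λ₁ n} × {n // 0 < Λ₁ n} := fun b => (⟨_, hP1 b⟩, ⟨_, hP2 b⟩) with hf
  have hfinj : Function.Injective f := fun b b' h => by
    simp only [hf, Prod.mk.injEq, Subtype.mk.injEq] at h
    exact Subtype.ext (Prod.ext h.1 h.2)
  set B := ∑ b ∈ R, max (Λ₂ b.1 * Λ₂ b.2 - c) 0 with hB
  -- Above the threshold, side 1 has the full allowance B of side 2 plus the surplus of the pair
  -- (0,k).
  have hsumP : ∑ b ∈ P, (Λ₁ b.1 * Λ₁ b.2 - c) = (Λ₁ 0 * Λ₁ k - c) + B := by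
    rw [hP, Finset.sum_insert (by simp [hR]), Finset.sum_filter, hB]
    congr 1
    refine Finset.sum_congr rfl fun b hb => ?_
    rw [hR, Finset.mem_product, Finset.mem_range, Finset.mem_range] at hb
    rw [hk _ hb.1, hk _ hb.2]
    split_ifs with h
    · exact (max_eq_left (sub_nonneg.2 h.le)).symm
    · exact (max_eq_right (sub_nonpos.2 (not_lt.1 h))).symm
  -- The lower bound loses |P|ε and the upper bound gains ε; this choice makes the total half of the
  -- surplus.
  set ε := (Λ₁ 0 * Λ₁ k - c) / (2 * (P.card + 1)) with hε
  have hε0 : 0 < ε := div_pos (sub_pos.2 hck) (by positivity)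
  obtain ⟨n, ⟨p, hp, hpω⟩, hn⟩ := ((hδ₁.eventually_exists_isMinimalFamily hω₁ hinv₁ hfinj hε0).and
    (hδ₂.eventually_sum_le hω₂ hinv₂ P hc0 (sum_pos_part_le hΛ₂ hΛ₂0 k) hε0)).exists
  have h1 := hn _ (hp.map (α n) (hα n)) fun a => ((hα n _).1 (hp.mem a)).1
  have h2 : ∑ b ∈ P, Λ₁ b.1 * Λ₁ b.2 - P.card * ε ≤
      ∑ a : P, (ω₂.val (α n (p a)) ((hα n _).1 (hp.mem a)).1).re := by
    have h3 : ∑ b ∈ P, Λ₁ b.1 * Λ₁ b.2 - P.card * ε =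
        ∑ a : P, (Λ₁ a.1.1 * Λ₁ a.1.2 - ε) := by
      rw [Finset.sum_sub_distrib, Finset.sum_coe_sort P (fun b => Λ₁ b.1 * Λ₁ b.2)]
      simp
    rw [h3]
    refine Finset.sum_le_sum fun a _ => ?_
    rw [hαω n _ (hp.mem a) ((hα n _).1 (hp.mem a))]
    exact hpω a _
  have h4 : Fintype.card P = P.card := Fintype.card_coe P
  rw [h4] at h1
  have h5 : ∑ b ∈ P, (Λ₁ b.1 * Λ₁ b.2 - c) = ∑ b ∈ P, Λ₁ b.1 * Λ₁ b.2 - P.card * c := by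
    rw [Finset.sum_sub_distrib]
    simp
  have h6 : (Λ₁ 0 * Λ₁ k - c) = 2 * ((P.card + 1) * ε) := by
    have : (2 * ((P.card : ℝ) + 1)) ≠ 0 := mul_ne_zero two_ne_zero P.card.cast_add_one_ne_zero
    rw [← mul_assoc, hε, mul_div_cancel₀ _ this]
  have h7 : 0 < (P.card + 1) * ε := mul_pos P.card.cast_add_one_pos hε0
  linarith

end Comparison

/-! ### The two semigroups of an interaction and the effect of triviality. -/

section Trivial

variable {H : Type u} [NormedAddCommGroup H] [InnerProductSpace ℂ H] [CompleteSpace H]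

/-- The algebras γ_t(M) increase with t, so membership for t ≤ 0 already gives membership in the
full intersection, which is scalar. -/
theorem History.isPureSemigroup_past (h : History H) :
    IsPureSemigroup h.M fun t => h.γ (-t) where
  add s t X := by rw [neg_add, h.γ_add]
  norm t X := h.norm_γ _ X
  mem t ht X hX := h.γ_mem (neg_nonpos.2 ht) hX
  pure Y hY := by
    have h1 : Y ∈ ⋂ t, Unitary.conjStarAlgAut ℂ (H →L[ℂ] H) (h.U t) '' (h.M : Set (H →L[ℂ] H)) := by
      rw [Set.mem_iInter]
      intro t
      refine ⟨h.γ (-t) Y, ?_, ?_⟩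
      · rcases le_total 0 t with ht | ht
        · have h2 := hY 0 le_rfl
          rw [neg_neg, h.γ_zero] at h2
          exact h.γ_mem (neg_nonpos.2 ht) h2
        · simpa using hY (-t) (neg_nonneg.2 ht)
      · change h.γ t (h.γ (-t) Y) = Y
        rw [← h.γ_add, add_neg_cancel, h.γ_zero]
    rw [h.trivial_past] at h1
    obtain ⟨c, hc⟩ := h1
    exact ⟨c, hc.symm⟩

/-- An operator commuting with all bounded operators is a scalar. -/
theorem exists_eq_smul_one_of_forall_commute {Y : H →L[ℂ] H} (hY : ∀ X, Commute X Y) :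
    ∃ c : ℂ, Y = c • 1 := by
  by_cases h : ∃ x : H, x ≠ 0
  · obtain ⟨x, hx⟩ := h
    have hxx : ⟪x, x⟫_ℂ ≠ 0 := inner_self_ne_zero.2 hx
    refine ⟨⟪x, Y x⟫_ℂ / ⟪x, x⟫_ℂ, ?_⟩
    ext z
    have h1 := congrArg (fun T : H →L[ℂ] H => T x) (hY (rankOne ℂ z x)).eq
    rw [mul_apply_eq_comp, mul_apply_eq_comp, rankOne_apply, rankOne_apply, map_smul] at h1
    change Y z = (⟪x, Y x⟫_ℂ / ⟪x, x⟫_ℂ) • z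
    rw [div_eq_inv_mul, mul_smul, h1, smul_smul, inv_mul_cancel₀ hxx, one_smul]
  · push Not at h
    exact ⟨0, ContinuousLinearMap.ext fun x => by rw [h x]; simp⟩

/-- An operator in every γ_t(M') commutes with all translates of M; these generate B(H), so it is
central. -/
theorem History.isPureSemigroup_future (h : History H) :
    IsPureSemigroup h.M.commutant h.γ where
  add s t X := h.γ_add s t X
  norm t X := h.norm_γ _ X
  mem t ht X hX := h.γ_mem_commutant ht hX
  pure Y hY := by
    apply exists_eq_smul_one_of_forall_commute
    have hc : Y ∈ Set.centralizer
        (⋃ t, Unitary.conjStarAlgAut ℂ (H →L[ℂ] H) (h.U t) '' (h.M : Set (H →L[ℂ] H))) := by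
      intro Z hZ
      obtain ⟨t, X, hX, rfl⟩ := Set.mem_iUnion.1 hZ
      have h1 : h.γ (-t) Y ∈ h.M.commutant := by
        rcases le_total 0 t with ht | ht
        · exact hY t ht
        · have h2 := hY 0 le_rfl
          rw [neg_zero, h.γ_zero] at h2
          exact h.γ_mem_commutant (neg_nonneg.2 ht) h2
      have h3 := congrArg (h.γ t) (VonNeumannAlgebra.mem_commutant_iff.1 h1 X hX)
      rwa [map_mul, map_mul, ← h.γ_add, add_neg_cancel, h.γ_zero] at h3
    intro X
    have hX : X ∈ Set.centralizer (Set.centralizer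
        (⋃ t, Unitary.conjStarAlgAut ℂ (H →L[ℂ] H) (h.U t) '' (h.M : Set (H →L[ℂ] H)))) := by
      rw [h.irreducible]
      exact Set.mem_univ X
    exact (hX Y hc).symm

/-- Together with the analogue for the future, this makes γ_t an isomorphism between the relative
commutants of the two semigroups. -/
theorem History.mem_relCommutantIn_past (h : History H) (t : ℝ) (X : H →L[ℂ] H) :
    X ∈ relCommutantIn h.M (h.γ (-t)) ↔ X ∈ h.localAlg (-t) 0 := by
  rw [h.mem_localAlg, neg_zero, h.γ_zero, neg_neg, VonNeumannAlgebra.mem_commutant_iff]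
  refine and_congr Iff.rfl (forall₂_congr fun Y _ => ?_)
  rw [commute_iff_eq, eq_comm, ← (EquivLike.injective (h.γ t)).eq_iff, map_mul, map_mul,
    ← h.γ_add, add_neg_cancel, h.γ_zero]

theorem History.mem_relCommutantIn_future (h : History H) (t : ℝ) (X : H →L[ℂ] H) :
    X ∈ relCommutantIn h.M.commutant (h.γ t) ↔ X ∈ h.localAlg 0 t := by
  rw [h.mem_localAlg, neg_zero, h.γ_zero]
  refine Iff.trans (and_congr Iff.rfl ?_) and_comm
  conv_rhs => rw [← h.M.commutant_commutant, VonNeumannAlgebra.mem_commutant_iff]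
  refine forall₂_congr fun Y _ => ?_
  rw [commute_iff_eq, eq_comm, ← (EquivLike.injective (h.γ (-t))).eq_iff, map_mul, map_mul,
    ← h.γ_add, neg_add_cancel, h.γ_zero]

theorem History.mem_localAlg_past_iff (h : History H) (t : ℝ) (X : H →L[ℂ] H) :
    X ∈ h.localAlg (-t) 0 ↔ h.γ t X ∈ h.localAlg 0 t := by
  constructor
  · intro hX
    simpa using h.γ_mem_localAlg t hX
  · intro hX
    have := h.γ_mem_localAlg (-t) hX
    rwa [← h.γ_add, neg_add_cancel, h.γ_zero, zero_add, add_neg_cancel] at this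

/-- With φ the common invariant extension, ω₊(γ_t X) = φ(γ_t X) = φ(X) = ω₋(X). -/
theorem Interaction.val_future_eq_val_past (I : Interaction H) (hI : I.IsTrivial) {t : ℝ}
    (ht : 0 ≤ t) {X : H →L[ℂ] H} (hX : X ∈ I.localAlg (-t) 0) (hX' : I.γ t X ∈ I.localAlg 0 t) :
    I.ωp.val (I.γ t X) (I.localAlg_le_future le_rfl hX') =
      I.ωm.val X (I.localAlg_le_past le_rfl hX) := by
  have h1 := I.existsUnique_pastExtension.choose_spec.1
  have h2 := I.existsUnique_futureExtension.choose_spec.1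
  have hI' : I.existsUnique_pastExtension.choose = I.existsUnique_futureExtension.choose := hI
  rw [← hI'] at h2
  rw [← h1.2 (-t) 0 (by linarith) le_rfl X hX, ← h2.2 0 t ht le_rfl _ hX', h1.1]

variable {K₁ : Type*} [NormedAddCommGroup K₁] [InnerProductSpace ℂ K₁] [CompleteSpace K₁]
  {K₂ : Type*} [NormedAddCommGroup K₂] [InnerProductSpace ℂ K₂] [CompleteSpace K₂]
  {Λ₁ Λ₂ : ℕ → ℝ} {e₁ : {n // 0 < Λ₁ n} → K₁} {e₂ : {n // 0 < Λ₂ n} → K₂}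

theorem Interaction.eigenvalues_eq_of_isTrivial (I : Interaction H) (hI : I.IsTrivial)
    {θ₁ : I.M.toStarSubalgebra ≃⋆ₐ[ℂ] (K₁ →L[ℂ] K₁)}
    {θ₂ : I.M.commutant.toStarSubalgebra ≃⋆ₐ[ℂ] (K₂ →L[ℂ] K₂)}
    (hω₁ : IsDiagonalized θ₁ I.ωm (fun n : {n // 0 < Λ₁ n} => Λ₁ n) e₁)
    (hω₂ : IsDiagonalized θ₂ I.ωp (fun n : {n // 0 < Λ₂ n} => Λ₂ n) e₂)
    (hΛ₁ : Antitone Λ₁) (hΛ₁0 : ∀ n, 0 ≤ Λ₁ n) (hΛ₂ : Antitone Λ₂) (hΛ₂0 : ∀ n, 0 ≤ Λ₂ n) :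
    Λ₁ = Λ₂ := by
  have hiff : ∀ (n : ℕ) (X : H →L[ℂ] H), X ∈ relCommutantIn I.M (I.γ (-n)) ↔
      I.γ n X ∈ relCommutantIn I.M.commutant (I.γ n) := fun n X => by
    rw [I.mem_relCommutantIn_past, I.mem_relCommutantIn_future, I.mem_localAlg_past_iff]
  have hinv₁ : ∀ t, 0 ≤ t → ∀ X (hX : X ∈ I.M) (hX' : I.γ (-t) X ∈ I.M),
      I.ωm.val (I.γ (-t) X) hX' = I.ωm.val X hX :=
    fun t ht X hX _ => I.ωm_invariant (-t) (neg_nonpos.2 ht) X hX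
  have hinv₂ : ∀ t, 0 ≤ t → ∀ X (hX : X ∈ I.M.commutant) (hX' : I.γ t X ∈ I.M.commutant),
      I.ωp.val (I.γ t X) hX' = I.ωp.val X hX :=
    fun t ht X hX _ => I.ωp_invariant t ht X hX
  have hval : ∀ (n : ℕ) X (h₁ : X ∈ relCommutantIn I.M (I.γ (-n)))
      (h₂ : I.γ n X ∈ relCommutantIn I.M.commutant (I.γ n)),
      I.ωp.val (I.γ n X) h₂.1 = I.ωm.val X h₁.1 := fun n X h₁ h₂ =>
    I.val_future_eq_val_past hI n.cast_nonneg ((I.mem_relCommutantIn_past n X).1 h₁)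
      ((I.mem_relCommutantIn_future n _).1 h₂)
  have hback : ∀ (n : ℕ) (X : H →L[ℂ] H), I.γ n (I.γ (-n) X) = X := fun n X => by
    rw [← I.γ_add, add_neg_cancel, I.γ_zero]
  funext k
  induction k using Nat.strong_induction_on with
  | _ k ih =>
    refine le_antisymm ?_ ?_
    · exact eigenvalue_le_of_forall_lt_eq I.isPureSemigroup_past I.isPureSemigroup_future
        hinv₁ hinv₂ hω₁ hω₂ hΛ₁ hΛ₁0 hΛ₂ hΛ₂0 (fun n => I.γ n) hiff hval k ih
    -- The comparison is symmetric: interchange the sides and use γ_{-n} in place of γ_n.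
    · refine eigenvalue_le_of_forall_lt_eq I.isPureSemigroup_future I.isPureSemigroup_past
        hinv₂ hinv₁ hω₂ hω₁ hΛ₂ hΛ₂0 hΛ₁ hΛ₁0 (fun n => I.γ (-n)) ?_ ?_ k
        fun i hi => (ih i hi).symm
      · intro n X
        rw [hiff, hback]
      · intro n X h₁ h₂
        rw [← hval n _ h₂ (by rwa [hback])]
        congr 1
        exact hback n X

end Trivial

/-! ### Decreasing rearrangement of families of real numbers. -/

section Rearrangement

/-- Two nonnegative families in which every positive value occurs equally often are rearrangements
of each other. -/
theorem exists_equiv_of_encard_eq {α β : Type*} {f : α → ℝ} {g : β → ℝ}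
    (hg : ∀ c, 0 < c → {b | g b = c}.Finite)
    (h : ∀ c, 0 < c → {a | f a = c}.encard = {b | g b = c}.encard) :
    ∃ σ : {a // 0 < f a} ≃ {b // 0 < g b}, ∀ a, g (σ a) = f a := by
  have h1 : ∀ c, Nonempty ({a : {a // 0 < f a} // f a = c} ≃ {b : {b // 0 < g b} // g b = c}) := by
    intro c
    by_cases hc : 0 < c
    · have e1 : {a : {a // 0 < f a} // f a = c} ≃ {a | f a = c} :=
        { toFun := fun a => ⟨a.1.1, a.2⟩
          invFun := fun a => ⟨⟨a.1, hc.trans_eq a.2.symm⟩, a.2⟩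
          left_inv := fun _ => rfl
          right_inv := fun _ => rfl }
      have e2 : {b : {b // 0 < g b} // g b = c} ≃ {b | g b = c} :=
        { toFun := fun a => ⟨a.1.1, a.2⟩
          invFun := fun a => ⟨⟨a.1, hc.trans_eq a.2.symm⟩, a.2⟩
          left_inv := fun _ => rfl
          right_inv := fun _ => rfl }
      have hfin : {a | f a = c}.Finite := by
        rw [← Set.encard_lt_top_iff, h c hc, Set.encard_lt_top_iff]
        exact hg c hc
      have := hfin.to_subtype
      have := (hg c hc).to_subtype
      have hcard : Nat.card {a | f a = c} = Nat.card {b | g b = c} := by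
        rw [Nat.card_coe_set_eq, Nat.card_coe_set_eq, Set.ncard, Set.ncard, h c hc]
      obtain ⟨e⟩ := Finite.card_eq.1 hcard
      exact ⟨e1.trans (e.trans e2.symm)⟩
    · have : IsEmpty {a : {a // 0 < f a} // f a = c} := ⟨fun a => hc (a.1.2.trans_eq a.2)⟩
      have : IsEmpty {b : {b // 0 < g b} // g b = c} := ⟨fun a => hc (a.1.2.trans_eq a.2)⟩
      exact ⟨Equiv.equivOfIsEmpty _ _⟩
  exact ⟨Equiv.ofFiberEquiv fun c => (h1 c).some, fun a =>
    Equiv.ofFiberEquiv_map (f := fun a : {a // 0 < f a} => f a)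
      (g := fun b : {b // 0 < g b} => g b) (fun c => (h1 c).some) a⟩

/-- Decreasing rearrangement of a nonnegative family which is bounded and has only finitely many
members above every positive level. -/
theorem exists_antitone_rearrangement {ι : Type*} {w : ι → ℝ} {C : ℝ} (hC : ∀ i, w i ≤ C)
    (hw : ∀ c, 0 < c → {i | c ≤ w i}.Finite) :
    ∃ Λ : ℕ → ℝ, Antitone Λ ∧ (∀ n, 0 ≤ Λ n) ∧
      ∀ c, 0 < c → {n | Λ n = c}.encard = {i | w i = c}.encard := by
  -- Λ n will be the supremum of the positive levels reached by more than n members, so that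
  -- counting members above a level decides how Λ n compares with it.
  set S : ℕ → Set ℝ := fun n => {c | 0 < c ∧ n < {i | c ≤ w i}.ncard} with hS
  have hbdd : ∀ n, BddAbove (S n) := by
    intro n
    refine ⟨C, fun c hc => ?_⟩
    obtain ⟨i, hi⟩ := (Set.ncard_pos (hw c hc.1)).1 (Nat.zero_lt_of_lt hc.2)
    exact le_trans hi (hC i)
  set Λ : ℕ → ℝ := fun n => sSup (S n) with hΛ
  have hlt : ∀ n c, 0 < c → (c < Λ n ↔ n < {i | c < w i}.ncard) := by
    intro n c hc
    have hfin : {i | c < w i}.Finite := (hw c hc).subset fun i (hi : c < w i) => hi.le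
    constructor
    · intro h
      have hne : (S n).Nonempty := by
        by_contra hne
        rw [Set.not_nonempty_iff_eq_empty] at hne
        rw [hΛ] at h
        simp only [hne, Real.sSup_empty] at h
        exact lt_asymm h hc
      obtain ⟨d, hd, hcd⟩ := exists_lt_of_lt_csSup hne h
      exact hd.2.trans_le (Set.ncard_le_ncard (fun i (hi : d ≤ w i) => hcd.trans_le hi) hfin)
    · intro h
      -- Finitely many members exceed c, so the level can be raised a little without losing any of
      -- them.
      obtain ⟨d, hdw, hd⟩ : ∃ d, (∀ i ∈ {i | c < w i}, d ≤ w i) ∧ c < d := by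
        have h1 : ∀ᶠ d in 𝓝[>] c, ∀ i ∈ {i | c < w i}, d ≤ w i :=
          (eventually_all_finite hfin).2 fun i hi =>
            nhdsWithin_le_nhds ((gt_mem_nhds hi).mono fun _ => le_of_lt)
        exact (h1.and self_mem_nhdsWithin).exists
      refine hd.trans_le (le_csSup (hbdd n) ⟨hc.trans hd, h.trans_le ?_⟩)
      exact Set.ncard_le_ncard hdw (hw d (hc.trans hd))
  have hle : ∀ n c, 0 < c → (c ≤ Λ n ↔ n < {i | c ≤ w i}.ncard) := by
    intro n c hc
    constructor
    · intro h
      -- Only finitely many members lie in [c/2, c), so some d < c exceeds them all: above d and at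
      -- or above c then mean the same.
      obtain ⟨d, hdw, hd0, hd⟩ : ∃ d, (∀ i ∈ {i | c / 2 ≤ w i} \ {i | c ≤ w i}, w i < d) ∧
          c / 2 < d ∧ d < c := by
        have h1 : ∀ᶠ d in 𝓝[<] c, ∀ i ∈ {i | c / 2 ≤ w i} \ {i | c ≤ w i}, w i < d :=
          (eventually_all_finite ((hw _ (half_pos hc)).sdiff)).2 fun i hi =>
            nhdsWithin_le_nhds (lt_mem_nhds (not_le.1 hi.2))
        have h2 : ∀ᶠ d in 𝓝[<] c, c / 2 < d :=
          nhdsWithin_le_nhds (lt_mem_nhds (half_lt_self hc))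
        exact (h1.and (h2.and self_mem_nhdsWithin)).exists
      refine ((hlt n d ((half_pos hc).trans hd0)).1 (hd.trans_le h)).trans_le
        (Set.ncard_le_ncard (fun i (hi : d < w i) => ?_) (hw c hc))
      by_contra hic
      exact lt_asymm hi (hdw i ⟨(hd0.trans hi).le, hic⟩)
    · intro h
      exact le_csSup (hbdd n) ⟨hc, h⟩
  refine ⟨Λ, fun m n hmn => ?_, fun n => Real.sSup_nonneg fun c hc => hc.1.le, fun c hc => ?_⟩
  · rcases (S n).eq_empty_or_nonempty with h | h
    · have : Λ n = 0 := by simp only [hΛ, h, Real.sSup_empty]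
      rw [this]
      exact Real.sSup_nonneg fun c hc => hc.1.le
    · exact csSup_le_csSup (hbdd m) h fun c hc => ⟨hc.1, hmn.trans_lt hc.2⟩
  · have hfin : {i | c ≤ w i}.Finite := hw c hc
    have hsub : {i | c < w i} ⊆ {i | c ≤ w i} := fun i (hi : c < w i) => hi.le
    -- The indices with value c form the interval from #{w > c} (included) to #{w ≥ c} (excluded),
    -- whose length is the number of members equal to c.
    have e1 : {n | Λ n = c} =
        Set.Iio {i | c ≤ w i}.ncard \ Set.Iio {i | c < w i}.ncard := by
      ext n
      simp only [Set.mem_ofPred_eq, Set.mem_sdiff, Set.mem_Iio, ← hlt n c hc, ← hle n c hc, not_lt]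
      exact ⟨fun h => ⟨h.ge, h.le⟩, fun h => le_antisymm h.2 h.1⟩
    have e2 : {i | w i = c} = {i | c ≤ w i} \ {i | c < w i} := by
      ext i
      simp only [Set.mem_ofPred_eq, Set.mem_sdiff, not_lt]
      exact ⟨fun h => ⟨h.ge, h.le⟩, fun h => le_antisymm h.2 h.1⟩
    have hfinite1 : (Set.Iio {i | c ≤ w i}.ncard \ Set.Iio {i | c < w i}.ncard).Finite :=
      (Set.finite_Iio _).sdiff
    rw [e1, e2, ← hfinite1.cast_ncard_eq, ← (hfin.sdiff).cast_ncard_eq,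
      Set.ncard_sdiff (Set.Iio_subset_Iio (Set.ncard_le_ncard hsub hfin)) (Set.finite_Iio _),
      Set.ncard_sdiff hsub (hfin.subset hsub)]
    simp [← Nat.card_coe_set_eq]

end Rearrangement

/-! ### Eigenbases, and compactness of positive operators with finite trace. -/

section Spectral

variable {K : Type u} [NormedAddCommGroup K] [InnerProductSpace ℂ K] [CompleteSpace K]

/-- A compact self-adjoint operator has a Hilbert basis of eigenvectors. -/
theorem exists_hilbertBasis_eigenvectors {R : K →L[ℂ] K} (hc : IsCompactOperator R)
    (hR : (R : K →ₗ[ℂ] K).IsSymmetric) :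
    ∃ (ι : Type u) (b : HilbertBasis ι ℂ K) (w : ι → ℂ), ∀ i, R (b i) = w i • b i := by
  set E : ℂ → Submodule ℂ K := fun μ => Module.End.eigenspace (R : K →ₗ[ℂ] K) μ with hE
  have hcl : ∀ μ, IsClosed (E μ : Set K) := by
    intro μ
    have : (E μ : Set K) = {x | R x = μ • x} := by
      ext x
      exact Module.End.mem_eigenspace_iff
    rw [this]
    exact isClosed_eq R.continuous (continuous_const_smul μ)
  have hcomp : ∀ μ, CompleteSpace (E μ) := fun μ => (hcl μ).completeSpace_coe
  choose s b hb using fun μ => exists_hilbertBasis ℂ (E μ)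
  have hv : Orthonormal ℂ fun a : Σ μ, s μ => ((b a.1 a.2 : E a.1) : K) :=
    hR.orthogonalFamily_eigenspaces.orthonormal_sigma_orthonormal
    (v_family := fun μ => b μ) fun μ => (b μ).orthonormal
  -- A vector orthogonal to the bases of all eigenspaces is orthogonal to the eigenspaces
  -- themselves, which are total by the spectral theorem.
  have hsp : (Submodule.span ℂ (Set.range fun a : (Σ μ, s μ) => ((b a.1 a.2 : E a.1) : K)))ᗮ = ⊥ := by
    rw [eq_bot_iff, ← R.orthogonalComplement_iSup_eigenspaces_eq_bot hc hR]
    intro x hx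
    rw [Submodule.mem_orthogonal'] at hx
    rw [← Submodule.iInf_orthogonal, Submodule.mem_iInf]
    intro μ
    rw [Submodule.mem_orthogonal']
    intro y hy
    have h1 := (((b μ).hasSum_repr ⟨y, hy⟩).mapL (E μ).subtypeL).mapL (innerSL ℂ x)
    refine h1.unique ?_
    convert! hasSum_zero with i
    have h2 := hx (b μ i : E μ) (Submodule.subset_span ⟨⟨μ, i⟩, rfl⟩)
    simp [h2]
  refine ⟨Σ μ, s μ, HilbertBasis.mkOfOrthogonalEqBot hv hsp, fun a => a.1, fun a => ?_⟩
  rw [HilbertBasis.coe_mkOfOrthogonalEqBot]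
  exact Module.End.mem_eigenspace_iff.1 (b a.1 a.2).2

theorem norm_sub_sum_sq {ι : Type*} {b : ι → K} (hb : Orthonormal ℂ b) (F : Finset ι) (y : K) :
    ‖y - ∑ i ∈ F, ⟪b i, y⟫_ℂ • b i‖ ^ 2 = ‖y‖ ^ 2 - ∑ i ∈ F, ‖⟪b i, y⟫_ℂ‖ ^ 2 := by
  have h1 : ⟪y, ∑ i ∈ F, ⟪b i, y⟫_ℂ • b i⟫_ℂ = ((∑ i ∈ F, ‖⟪b i, y⟫_ℂ‖ ^ 2 : ℝ) : ℂ) := by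
    rw [inner_sum]
    push_cast
    refine Finset.sum_congr rfl fun i _ => ?_
    rw [inner_smul_right, ← inner_conj_symm y (b i), Complex.mul_conj']
  have h2 : ⟪∑ i ∈ F, ⟪b i, y⟫_ℂ • b i, ∑ i ∈ F, ⟪b i, y⟫_ℂ • b i⟫_ℂ =
      ((∑ i ∈ F, ‖⟪b i, y⟫_ℂ‖ ^ 2 : ℝ) : ℂ) := by
    rw [hb.inner_sum]
    push_cast
    refine Finset.sum_congr rfl fun i _ => ?_
    rw [Complex.conj_mul']
  rw [@norm_sub_sq ℂ, h1, ← inner_self_eq_norm_sq (𝕜 := ℂ) (∑ i ∈ F, ⟪b i, y⟫_ℂ • b i), h2]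
  simp only [RCLike.re_eq_complex_re, Complex.ofReal_re]
  ring

theorem isCompactOperator_sum_rankOne {ι : Type*} (F : Finset ι) (f g : ι → K) :
    IsCompactOperator (∑ i ∈ F, rankOne ℂ (f i) (g i) : K →L[ℂ] K) := by
  classical
  induction F using Finset.induction_on with
  | empty => exact isCompactOperator_zero
  | insert i F hi ih =>
    rw [Finset.sum_insert hi]
    refine IsCompactOperator.add ?_ ih
    have h : IsCompactOperator (innerSL ℂ (g i)) :=
      (isCompactOperator_id (E := ℂ)).comp_clm _
    rw [rankOne_def']
    exact h.clm_comp (toSpanSingleton ℂ (f i))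

/-- A positive operator with finite trace is compact. -/
theorem isCompactOperator_of_hasSum {R : K →L[ℂ] K} (hR : 0 ≤ R) {ι : Type*}
    (b : HilbertBasis ι ℂ K) {z : ℝ} (hz : HasSum (fun i => (⟪b i, R (b i)⟫_ℂ).re) z) :
    IsCompactOperator R := by
  set S := CFC.sqrt R with hS
  have hSsa : adjoint S = S := (CFC.sqrt_nonneg R).isSelfAdjoint.star_eq
  have hSS : S * S = R := CFC.sqrt_mul_sqrt_self R hR
  have hsq : ∀ i, (⟪b i, R (b i)⟫_ℂ).re = ‖S (b i)‖ ^ 2 := by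
    intro i
    rw [← hSS, mul_apply_eq_comp, ← adjoint_inner_left, hSsa, inner_self_eq_norm_sq_to_K]
    norm_cast
  simp only [hsq] at hz
  set p : Finset ι → K →L[ℂ] K := fun F => ∑ i ∈ F, rankOne ℂ (b i) (b i) with hp
  -- √R is Hilbert–Schmidt: the part of √R v outside F is at most ‖v‖² times the tail of ∑‖√R b_i‖²,
  -- so the finite rank operators p_F √R converge in norm.
  have hbound : ∀ F v, ‖(S - p F * S) v‖ ^ 2 ≤ (z - ∑ i ∈ F, ‖S (b i)‖ ^ 2) * ‖v‖ ^ 2 := by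
    intro F v
    have h1 : (S - p F * S) v = S v - ∑ i ∈ F, ⟪b i, S v⟫_ℂ • b i := by
      simp [hp, sum_apply]
    have h2 : HasSum (fun i => ‖⟪b i, S v⟫_ℂ‖ ^ 2) (‖S v‖ ^ 2) := by
      have := b.hasSum_inner_mul_inner (S v) (S v)
      rw [inner_self_eq_norm_sq_to_K] at this
      have h3 := Complex.hasSum_re this
      convert! h3 using 1
      · ext i
        rw [← inner_conj_symm (S v) (b i), Complex.conj_mul']
        norm_cast
      · norm_cast
    have h3 := sum_le_hasSum F (fun i _ => ?_) ((hz.mul_right (‖v‖ ^ 2)).sub h2)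
    · rw [h1, norm_sub_sum_sq b.orthonormal]
      rw [Finset.sum_sub_distrib, ← Finset.sum_mul] at h3
      linarith
    · have h4 : ⟪b i, S v⟫_ℂ = ⟪S (b i), v⟫_ℂ := by rw [← adjoint_inner_left, hSsa]
      rw [sub_nonneg, h4, ← mul_pow]
      gcongr
      exact norm_inner_le_norm _ _
  have hlim : Tendsto (fun F => p F * S) atTop (𝓝 S) := by
    rw [tendsto_iff_norm_sub_tendsto_zero]
    have h1 : Tendsto (fun F : Finset ι => √(z - ∑ i ∈ F, ‖S (b i)‖ ^ 2)) atTop (𝓝 0) := by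
      have h2 : Tendsto (fun F : Finset ι => z - ∑ i ∈ F, ‖S (b i)‖ ^ 2) atTop (𝓝 (z - z)) :=
        tendsto_const_nhds.sub hz
      simpa using h2.sqrt
    refine squeeze_zero (fun _ => norm_nonneg _) (fun F => ?_) h1
    rw [norm_sub_rev]
    refine ContinuousLinearMap.opNorm_le_bound _ (Real.sqrt_nonneg _) fun v => ?_
    have h0 : 0 ≤ z - ∑ i ∈ F, ‖S (b i)‖ ^ 2 :=
      sub_nonneg.2 (sum_le_hasSum F (fun _ _ => by positivity) hz)
    rw [← Real.sqrt_sq (norm_nonneg v), ← Real.sqrt_mul h0]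
    exact Real.le_sqrt_of_sq_le (hbound F v)
  have hcS : IsCompactOperator S := by
    refine isCompactOperator_of_tendsto hlim (Eventually.of_forall fun F => ?_)
    exact (isCompactOperator_sum_rankOne F b b).comp_clm S
  rw [← hSS]
  exact hcS.clm_comp S

end Spectral

/-! ### Diagonalizing a state along its eigenvalue list. -/

section TraceClass

variable {K : Type u} [NormedAddCommGroup K] [InnerProductSpace ℂ K] [CompleteSpace K]

/-- A positive operator with a trace has a Hilbert basis of eigenvectors, with summable
eigenvalues. -/
theorem exists_hilbertBasis_of_hasTrace {R : K →L[ℂ] K} (hR : 0 ≤ R) {z : ℂ} (hz : HasTrace R z) :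
    ∃ (ι : Type u) (b : HilbertBasis ι ℂ K) (w : ι → ℝ), (∀ i, 0 ≤ w i) ∧
      (∀ i, R (b i) = (w i : ℂ) • b i) ∧ HasSum w z.re := by
  obtain ⟨s, b₀, -⟩ := exists_hilbertBasis ℂ K
  have hc := isCompactOperator_of_hasSum hR b₀ (Complex.hasSum_re (hz s b₀))
  obtain ⟨ι, b, w, hb⟩ := exists_hilbertBasis_eigenvectors hc
    ((nonneg_iff_isPositive R).1 hR).isSymmetric
  have hw : ∀ i, ⟪b i, R (b i)⟫_ℂ = w i := fun i => by
    rw [hb, inner_smul_right, inner_self_eq_norm_sq_to_K, b.orthonormal.1]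
    simp
  have hpos : ∀ i, 0 ≤ w i := fun i => by
    rw [← hw]
    exact ((nonneg_iff_isPositive R).1 hR).inner_nonneg_right _
  have hre : ∀ i, w i = ((w i).re : ℂ) := fun i =>
    Complex.ext rfl (Complex.nonneg_iff.1 (hpos i)).2.symm
  refine ⟨ι, b, fun i => (w i).re, fun i => (Complex.nonneg_iff.1 (hpos i)).1, fun i => ?_, ?_⟩
  · rw [hb, ← hre]
  · have := Complex.hasSum_re (hz ι b)
    simpa only [hw] using this

theorem finite_setOf_le_of_hasSum {ι : Type*} {w : ι → ℝ} {z : ℝ} (hz : HasSum w z) {c : ℝ}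
    (hc : 0 < c) : {i | c ≤ w i}.Finite := by
  have h := hz.summable.tendsto_cofinite_zero.eventually (gt_mem_nhds hc)
  rw [eventually_cofinite] at h
  simpa using h

/-- The multiplicity of an eigenvalue can be read off from a Hilbert basis of eigenvectors. -/
theorem toENat_rank_eigenspace {R : K →L[ℂ] K} {ι : Type*} (b : HilbertBasis ι ℂ K) {w : ι → ℝ}
    (hb : ∀ i, R (b i) = (w i : ℂ) • b i) (hR : adjoint R = R) {c : ℝ}
    (hc : {i | w i = c}.Finite) :
    Cardinal.toENat (Module.rank ℂ (Module.End.eigenspace (R : K →ₗ[ℂ] K) (c : ℂ))) =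
      {i | w i = c}.encard := by
  have h1 : Module.End.eigenspace (R : K →ₗ[ℂ] K) (c : ℂ) =
      Submodule.span ℂ (b '' {i | w i = c}) := by
    apply le_antisymm
    · intro x hx
      have hx' : R x = (c : ℂ) • x := Module.End.mem_eigenspace_iff.1 hx
      -- An eigenvector for c has no component along basis vectors with another eigenvalue, so its
      -- expansion is finite.
      have h2 : ∀ i ∉ hc.toFinset, ⟪b i, x⟫_ℂ • b i = 0 := by
        intro i hi
        have h3 : ⟪b i, R x⟫_ℂ = (w i : ℂ) * ⟪b i, x⟫_ℂ := by
          rw [← adjoint_inner_left, hR, hb, inner_smul_left, Complex.conj_ofReal]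
        rw [hx', inner_smul_right] at h3
        have h4 : (c : ℂ) ≠ w i := fun h => hi (by
          simp only [Set.Finite.mem_toFinset, Set.mem_ofPred_eq]
          exact_mod_cast h.symm)
        have h5 : ⟪b i, x⟫_ℂ = 0 := by
          by_contra h
          exact h4 (mul_right_cancel₀ h h3)
        rw [h5, zero_smul]
      have h6 := b.hasSum_repr x
      simp only [b.repr_apply_apply] at h6
      rw [h6.unique (hasSum_sum_of_ne_finset_zero h2)]
      refine Submodule.sum_mem _ fun i hi => Submodule.smul_mem _ _ (Submodule.subset_span ?_)
      exact ⟨i, by simpa using hi, rfl⟩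
    · rw [Submodule.span_le]
      rintro _ ⟨i, hi, rfl⟩
      have hi' : w i = c := hi
      refine Module.End.mem_eigenspace_iff.2 ?_
      rw [← hi']
      exact hb i
  rw [h1, toENat_rank_span_set]
  exact b.orthonormal.linearIndependent.linearIndepOn _

variable {H : Type u} [NormedAddCommGroup H] [InnerProductSpace ℂ H] [CompleteSpace H]
  {M : VonNeumannAlgebra H} {ω : State M.toStarSubalgebra}

/-- The list records only multiplicities; an eigenbasis of R has the same ones, so a bijection
matches the positive parts. Vectors of eigenvalue zero contribute nothing to the trace. -/
theorem State.HasEigenvalueList.exists_isDiagonalized {Λ : ℕ → ℝ}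
    (h : State.HasEigenvalueList M ω Λ) :
    ∃ (K : Type u) (_ : NormedAddCommGroup K) (_ : InnerProductSpace ℂ K) (_ : CompleteSpace K)
      (θ : M.toStarSubalgebra ≃⋆ₐ[ℂ] (K →L[ℂ] K)) (e : {n // 0 < Λ n} → K),
      IsDiagonalized θ ω (fun n : {n // 0 < Λ n} => Λ n) e := by
  obtain ⟨K, _, _, _, θ, R, hR, htr, hΛ⟩ := h
  have hR0 : 0 ≤ R := (nonneg_iff_isPositive R).2 hR
  have hRa : adjoint R = R := hR0.isSelfAdjoint.star_eq
  have htr1 := htr 1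
  rw [map_one, mul_one] at htr1
  obtain ⟨ι, b, w, hw0, hb, hw⟩ := exists_hilbertBasis_of_hasTrace hR0 htr1
  have hfin : ∀ c, 0 < c → {i | w i = c}.Finite := fun c hc =>
    (finite_setOf_le_of_hasSum hw hc).subset fun i (hi : w i = c) => hi.ge
  obtain ⟨σ, hσ⟩ := exists_equiv_of_encard_eq hfin fun c hc => by
    rw [hΛ.multiplicity c hc, toENat_rank_eigenspace b hb hRa (hfin c hc)]
  refine ⟨K, _, _, _, θ, fun n => b (σ n), fun n => n.2,
    b.orthonormal.comp _ (Subtype.val_injective.comp σ.injective), fun x => ?_⟩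
  have h1 := htr x ι b
  have h2 : ∀ i, ⟪b i, (R * θ x) (b i)⟫_ℂ = (w i : ℂ) * ⟪b i, θ x (b i)⟫_ℂ := fun i => by
    rw [mul_apply_eq_comp, ← adjoint_inner_left, hRa, hb, inner_smul_left, Complex.conj_ofReal]
  simp only [h2] at h1
  have h3 : HasSum ((fun i => (w i : ℂ) * ⟪b i, θ x (b i)⟫_ℂ) ∘ ((↑) : {i // 0 < w i} → ι))
      (ω.toLinearMap x) := by
    refine (hasSum_subtype_iff_of_support_subset (s := {i | 0 < w i}) fun i hi => ?_).2 h1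
    refine (hw0 i).lt_of_ne fun h0 => hi ?_
    simp [← h0]
  have h4 := (Equiv.hasSum_iff σ).2 h3
  simpa [Function.comp_def, hσ] using h4

end TraceClass

/-! ### Normal states of type I factors have density operators. -/

section Normal

variable {K : Type u} [NormedAddCommGroup K] [InnerProductSpace ℂ K] [CompleteSpace K]

theorem rankOne_self_nonneg (x : K) : 0 ≤ rankOne ℂ x x :=
  (nonneg_iff_isPositive _).2 (isPositive_rankOne_self x)

theorem sum_rankOne_apply {ι : Type*} (b : ι → K) (F : Finset ι) (x : K) :
    (∑ i ∈ F, rankOne ℂ (b i) (b i)) x = ∑ i ∈ F, ⟪b i, x⟫_ℂ • b i := by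
  simp [sum_apply]

theorem re_inner_sum_rankOne {ι : Type*} (b : ι → K) (F : Finset ι) (x : K) :
    (⟪x, (∑ i ∈ F, rankOne ℂ (b i) (b i)) x⟫_ℂ).re = ∑ i ∈ F, ‖⟪b i, x⟫_ℂ‖ ^ 2 := by
  rw [sum_rankOne_apply, inner_sum, Complex.re_sum]
  refine Finset.sum_congr rfl fun i _ => ?_
  rw [inner_smul_right, ← inner_conj_symm x (b i), Complex.mul_conj']
  norm_cast

theorem sum_rankOne_le_one {ι : Type*} {b : ι → K} (hb : Orthonormal ℂ b) (F : Finset ι) :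
    ∑ i ∈ F, rankOne ℂ (b i) (b i) ≤ 1 := by
  rw [← sub_nonneg]
  refine nonneg_of_isSelfAdjoint ((IsSelfAdjoint.one _).sub
    (isSelfAdjoint_sum _ fun i _ => star_rankOne _ _)) fun x => ?_
  rw [sub_apply, inner_sub_right, Complex.sub_re, re_inner_sum_rankOne, one_apply_eq_self,
    inner_self_eq_norm_sq_to_K, sub_nonneg]
  convert! hb.sum_inner_products_le x (s := F) using 1
  norm_cast

/-- In the operator order, the identity is the supremum of the finite projections of a basis. -/
theorem one_le_of_forall_sum_rankOne_le {ι : Type*} (b : HilbertBasis ι ℂ K) {T : K →L[ℂ] K}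
    (hT : ∀ F : Finset ι, ∑ i ∈ F, rankOne ℂ (b i) (b i) ≤ T) : 1 ≤ T := by
  have h0 : 0 ≤ T := by simpa using hT ∅
  rw [← sub_nonneg]
  refine nonneg_of_isSelfAdjoint (h0.isSelfAdjoint.sub (IsSelfAdjoint.one _)) fun x => ?_
  have h1 : ∀ F : Finset ι, ∑ i ∈ F, ‖⟪b i, x⟫_ℂ‖ ^ 2 ≤ (⟪x, T x⟫_ℂ).re := by
    intro F
    have := re_inner_nonneg_of_nonneg (sub_nonneg.2 (hT F)) x
    rw [sub_apply, inner_sub_right, Complex.sub_re, re_inner_sum_rankOne] at this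
    linarith
  have h2 : HasSum (fun i => ‖⟪b i, x⟫_ℂ‖ ^ 2) (‖x‖ ^ 2) := by
    have h3 := Complex.hasSum_re (b.hasSum_inner_mul_inner x x)
    rw [inner_self_eq_norm_sq_to_K] at h3
    convert! h3 using 1
    · ext i
      rw [← inner_conj_symm x (b i), Complex.conj_mul']
      norm_cast
    · norm_cast
  have h4 : ‖x‖ ^ 2 ≤ (⟪x, T x⟫_ℂ).re := hasSum_le_of_sum_le h2 h1
  rw [sub_apply, inner_sub_right, Complex.sub_re, one_apply_eq_self, inner_self_eq_norm_sq_to_K]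
  have h5 : (((‖x‖ : ℂ)) ^ 2).re = ‖x‖ ^ 2 := by norm_cast
  change 0 ≤ _ - (((‖x‖ : ℂ)) ^ 2).re
  linarith

variable {H : Type u} [NormedAddCommGroup H] [InnerProductSpace ℂ H] [CompleteSpace H]
  {M : VonNeumannAlgebra H} (θ : M.toStarSubalgebra ≃⋆ₐ[ℂ] (K →L[ℂ] K))
  (ω : State M.toStarSubalgebra)

/-- A state of a type I factor as a positive functional on `B(K)`. -/
noncomputable def State.positiveFunctional : (K →L[ℂ] K) →ₚ[ℂ] ℂ :=
  PositiveLinearMap.mk₀ (ω.toLinearMap ∘ₗ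
    (θ.symm : (K →L[ℂ] K) →⋆ₐ[ℂ] M.toStarSubalgebra).toAlgHom.toLinearMap) (by
    intro T hT
    have h1 : T = star (CFC.sqrt T) * CFC.sqrt T := by
      rw [(CFC.sqrt_nonneg T).isSelfAdjoint.star_eq, CFC.sqrt_mul_sqrt_self _ hT]
    have h2 := ω.nonneg' (θ.symm (CFC.sqrt T))
    rw [← map_star, ← map_mul, ← h1] at h2
    exact h2)

theorem State.positiveFunctional_apply (T : K →L[ℂ] K) :
    ω.positiveFunctional θ T = ω.toLinearMap (θ.symm T) := rfl

theorem State.positiveFunctional_one : ω.positiveFunctional θ 1 = 1 := by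
  rw [State.positiveFunctional_apply, map_one, ω.map_one']

variable {ω}

/-- Normality is applied to the increasing finite projections of the basis. Their supremum in M is 1
because θ is an order isomorphism. -/
theorem State.IsNormal.tendsto_sum_rankOne (hω : ω.IsNormal M) {ι : Type*}
    (b : HilbertBasis ι ℂ K) :
    Tendsto (fun F : Finset ι => (ω.positiveFunctional θ (∑ i ∈ F, rankOne ℂ (b i) (b i))).re)
      atTop (𝓝 1) := by
  set p : Finset ι → K →L[ℂ] K := fun F => ∑ i ∈ F, rankOne ℂ (b i) (b i) with hp
  have hmono : Monotone p := fun F G h =>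
    Finset.sum_le_sum_of_subset_of_nonneg h fun i _ _ => rankOne_self_nonneg _
  have hle : ∀ S T : K →L[ℂ] K, S ≤ T ↔ θ.symm S ≤ θ.symm T := fun S T => by
    have := le_equiv_iff θ (θ.symm S) (θ.symm T)
    rw [StarAlgEquiv.apply_symm_apply, StarAlgEquiv.apply_symm_apply] at this
    exact this
  have hlub := hω (Set.range fun F => θ.symm (p F)) (Set.range_nonempty _) (by
      rintro _ ⟨F, rfl⟩
      have h1 : IsSelfAdjoint (p F) := isSelfAdjoint_sum _ fun i _ => star_rankOne _ _
      change star (θ.symm (p F)) = θ.symm (p F)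
      rw [← map_star, h1.star_eq]) (by
      refine directedOn_range.2 (Monotone.directed_le fun F G h => ?_)
      exact (hle _ _).1 (hmono h)) 1 (by
      constructor
      · rintro _ ⟨F, rfl⟩
        rw [← map_one θ.symm]
        exact (hle _ _).1 (sum_rankOne_le_one b.orthonormal F)
      · intro a ha
        have h1 : 1 ≤ θ a := one_le_of_forall_sum_rankOne_le b fun F => by
          rw [hle, StarAlgEquiv.symm_apply_apply]
          exact ha ⟨F, rfl⟩
        rw [hle, map_one, StarAlgEquiv.symm_apply_apply] at h1
        exact h1)
  rw [ω.map_one', Complex.one_re, ← Set.range_comp] at hlub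
  refine tendsto_atTop_isLUB (fun F G h => ?_) hlub
  exact (Complex.le_def.1 ((ω.positiveFunctional θ).monotone' (hmono h))).1

/-- Cauchy-Schwarz for positive functionals. -/
theorem norm_apply_star_mul_le (f : (K →L[ℂ] K) →ₚ[ℂ] ℂ) (S T : K →L[ℂ] K) :
    ‖f (star S * T)‖ ≤ √(f (star S * S)).re * √(f (star T * T)).re :=
  norm_inner_le_norm (𝕜 := ℂ) (f.toPreGNS S) (f.toPreGNS T)

theorem State.IsNormal.hasSum (hω : ω.IsNormal M) {ι : Type*} (b : HilbertBasis ι ℂ K)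
    (T : K →L[ℂ] K) :
    HasSum (fun i => ω.positiveFunctional θ (rankOne ℂ (T (b i)) (b i)))
      (ω.positiveFunctional θ T) := by
  set f := ω.positiveFunctional θ with hf
  set p : Finset ι → K →L[ℂ] K := fun F => ∑ i ∈ F, rankOne ℂ (b i) (b i) with hp
  have hsum : ∀ F : Finset ι, ∑ i ∈ F, f (rankOne ℂ (T (b i)) (b i)) = f (T * p F) := by
    intro F
    rw [hp, Finset.mul_sum, map_sum]
    refine Finset.sum_congr rfl fun i _ => ?_
    rw [ContinuousLinearMap.mul_def, comp_rankOne]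
  have hpp : ∀ F, star (1 - p F) * (1 - p F) = 1 - p F := by
    intro F
    have h1 : IsSelfAdjoint (p F) := isSelfAdjoint_sum _ fun i _ => star_rankOne _ _
    have h2 : p F * p F = p F := by
      conv_lhs => rw [hp]
      conv_rhs => rw [hp]
      dsimp only
      rw [Finset.mul_sum]
      refine Finset.sum_congr rfl fun j hj => ?_
      rw [ContinuousLinearMap.mul_def, comp_rankOne, sum_rankOne_apply,
        Finset.sum_eq_single j]
      · simp [inner_self_eq_norm_sq_to_K, b.orthonormal.1]
      · intro k _ hk
        simp [b.orthonormal.2 hk]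
      · exact fun h => absurd hj h
    rw [star_sub, star_one, h1.star_eq, mul_sub, mul_one, sub_mul, h2, one_mul, sub_self,
      sub_zero]
  -- Cauchy–Schwarz: |f(T(1 - p))|² ≤ f(TT*) f(1 - p), so convergence of f(p) to 1 controls every T.
  have hbound : ∀ F, ‖f (T * p F) - f T‖ ≤
      √(f (star (star T) * star T)).re * √(1 - (f (p F)).re) := by
    intro F
    have h1 : f (T * p F) - f T = -f (star (star T) * (1 - p F)) := by
      rw [star_star, mul_sub, mul_one, map_sub, neg_sub]
    have h2 := norm_apply_star_mul_le f (star T) (1 - p F)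
    rw [hpp, map_sub, hf, ω.positiveFunctional_one θ, ← hf, Complex.sub_re, Complex.one_re] at h2
    rw [h1, norm_neg]
    exact h2
  change Tendsto _ _ _
  simp only [SummationFilter.unconditional_filter, hsum]
  rw [tendsto_iff_norm_sub_tendsto_zero]
  refine squeeze_zero (fun _ => norm_nonneg _) hbound ?_
  have h3 := ((hω.tendsto_sum_rankOne θ b).const_sub 1).sqrt.const_mul
    √(f (star (star T) * star T)).re
  rw [sub_self, Real.sqrt_zero, mul_zero] at h3
  exact h3

/-- A normal state of a type I factor has a density operator. -/
theorem State.IsNormal.exists_density (hω : ω.IsNormal M) :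
    ∃ R : K →L[ℂ] K, 0 ≤ R ∧
      ∀ x : M.toStarSubalgebra, HasTrace (R * θ x) (ω.toLinearMap x) := by
  set f := ω.positiveFunctional θ with hf
  obtain ⟨C, hC⟩ := f.exists_norm_apply_le
  -- The values f(|u⟩⟨v|) form a bounded sesquilinear form; its representing operator is the density
  -- R.
  let B : K →L⋆[ℂ] K →L[ℂ] ℂ := LinearMap.mkContinuous₂
    (LinearMap.mk₂'ₛₗ (starRingEnd ℂ) (RingHom.id ℂ) (fun v u => f (rankOne ℂ u v))
      (fun v v' u => by simp) (fun c v u => by simp) (fun v u u' => by simp)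
      (fun c v u => by simp))
    C (fun v u => (hC _).trans_eq (by rw [norm_rankOne]; ring))
  set R := continuousLinearMapOfBilin B with hR
  have hRf : ∀ u v, ⟪R v, u⟫_ℂ = f (rankOne ℂ u v) := fun u v =>
    continuousLinearMapOfBilin_apply B v u
  have hsa : adjoint R = R := by
    refine ContinuousLinearMap.ext fun v => ext_inner_right ℂ fun u => ?_
    rw [adjoint_inner_left, hRf, ← inner_conj_symm, hRf, ← star_rankOne u v, map_star]
    simp
  have hR0 : 0 ≤ R := by
    refine nonneg_of_isSelfAdjoint hsa fun x => ?_
    have h1 : ⟪x, R x⟫_ℂ = f (rankOne ℂ x x) := by rw [← adjoint_inner_left, hsa, hRf]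
    rw [h1]
    exact (Complex.nonneg_iff.1 (f.map_nonneg (rankOne_self_nonneg x))).1
  refine ⟨R, hR0, fun x ι b => ?_⟩
  have h1 := hω.hasSum θ b (θ x)
  rw [ω.positiveFunctional_apply, StarAlgEquiv.symm_apply_apply] at h1
  have h2 : ∀ i, ⟪b i, (R * θ x) (b i)⟫_ℂ = f (rankOne ℂ (θ x (b i)) (b i)) := fun i => by
    rw [mul_apply_eq_comp, ← adjoint_inner_left, hsa, hRf]
  simpa only [h2] using h1

/-- A normal state of a type I factor has an eigenvalue list. -/
theorem State.IsNormal.exists_hasEigenvalueList (hω : ω.IsNormal M) (hM : IsTypeIFactor M) :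
    ∃ Λ, State.HasEigenvalueList M ω Λ := by
  obtain ⟨K, _, _, _, ⟨θ⟩⟩ := hM
  obtain ⟨R, hR0, hR⟩ := hω.exists_density θ
  have hRa : adjoint R = R := hR0.isSelfAdjoint.star_eq
  have htr := hR 1
  rw [map_one, mul_one] at htr
  obtain ⟨ι, b, w, hw0, hb, hw⟩ := exists_hilbertBasis_of_hasTrace hR0 htr
  have hfin : ∀ c, 0 < c → {i | w i = c}.Finite := fun c hc =>
    (finite_setOf_le_of_hasSum hw hc).subset fun i (hi : w i = c) => hi.ge
  obtain ⟨Λ, hanti, hnonneg, hΛ⟩ := exists_antitone_rearrangement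
    (fun i => le_hasSum hw i fun j _ => hw0 j) fun c hc => finite_setOf_le_of_hasSum hw hc
  obtain ⟨σ, hσ⟩ := exists_equiv_of_encard_eq hfin hΛ
  have hsummable : Summable Λ := by
    have h1 : Summable ((fun i => w i) ∘ ((↑) : {i // 0 < w i} → ι)) :=
      hw.summable.comp_injective Subtype.val_injective
    have h2 := h1.comp_injective σ.injective
    have h3 : Summable (Λ ∘ ((↑) : {n // 0 < Λ n} → ℕ)) := by
      simpa [Function.comp_def, hσ] using h2
    have h4 : Function.support Λ ⊆ {n | 0 < Λ n} := fun n hn =>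
      (hnonneg n).lt_of_ne (Ne.symm hn)
    exact (hasSum_subtype_iff_of_support_subset h4).1 h3.hasSum |>.summable
  exact ⟨Λ, K, _, _, _, θ, R, (nonneg_iff_isPositive R).1 hR0, hR, hanti, hnonneg, hsummable,
    fun μ hμ => by rw [hΛ μ hμ, toENat_rank_eigenspace b hb hRa (hfin μ hμ)]⟩

end Normal

/-! ### The commutant of a type I factor is of type I. -/

section Commutant

variable {H : Type u} [NormedAddCommGroup H] [InnerProductSpace ℂ H] [CompleteSpace H]
  {K : Type u} [NormedAddCommGroup K] [InnerProductSpace ℂ K] [CompleteSpace K]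
  {M : VonNeumannAlgebra H} (θ : M.toStarSubalgebra ≃⋆ₐ[ℂ] (K →L[ℂ] K))

/-- The representation of `B(K)` given by a type I factor is nondegenerate: no vector is annihilated
by all minimal projections of an orthonormal basis. -/
theorem eq_zero_of_forall_rep_rankOne_apply_eq_zero {ι : Type*} (b : HilbertBasis ι ℂ K) {z : H}
    (hz : ∀ i, rep θ (rankOne ℂ (b i) (b i)) z = 0) : z = 0 := by
  classical
  set p : Finset ι → K →L[ℂ] K := fun F => ∑ i ∈ F, rankOne ℂ (b i) (b i) with hp
  have hmono : Monotone p := fun F G h =>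
    Finset.sum_le_sum_of_subset_of_nonneg h fun i _ _ => rankOne_self_nonneg _
  have hle : ∀ S T : K →L[ℂ] K, S ≤ T ↔ rep θ S ≤ rep θ T := fun S T => by
    have := le_equiv_iff θ (θ.symm S) (θ.symm T)
    rwa [StarAlgEquiv.apply_symm_apply, StarAlgEquiv.apply_symm_apply] at this
  let U : Ultrafilter (Finset ι) := Ultrafilter.of atTop
  have hU : (U : Filter (Finset ι)) ≤ atTop := Ultrafilter.of_le _
  -- θ is not assumed to be weakly continuous; the order replaces continuity. The limit Y lies in M
  -- and dominates all the projections, hence Y ≥ 1, while ⟨z,Yz⟩ = 0.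
  obtain ⟨Y, hY⟩ := exists_weak_limit U (X := fun F => rep θ (p F)) (C := ‖(1 : K →L[ℂ] K)‖)
    fun F => (NonUnitalStarAlgHom.norm_apply_le (rep θ) _).trans
      (CStarAlgebra.norm_le_norm_of_nonneg_of_le
        (Finset.sum_nonneg fun i _ => rankOne_self_nonneg _) (sum_rankOne_le_one b.orthonormal F))
  have hYM : Y ∈ M := by
    rw [← M.commutant_commutant, VonNeumannAlgebra.mem_commutant_iff]
    intro Z hZ
    exact commute_of_weak_limit hY (Eventually.of_forall fun F =>
      (VonNeumannAlgebra.mem_commutant_iff.1 hZ _ (rep_mem θ _)).symm)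
  have hYge : ∀ F, rep θ (p F) ≤ Y := by
    intro F
    rw [← sub_nonneg, nonneg_iff_isPositive, isPositive_iff_complex]
    intro x
    have h1 : 0 ≤ ⟪x, (Y - rep θ (p F)) x⟫_ℂ := by
      rw [sub_apply, inner_sub_right]
      refine ge_of_tendsto ((hY x x).sub_const _) ?_
      filter_upwards [hU (eventually_ge_atTop F)] with G hG
      rw [← inner_sub_right, ← sub_apply]
      exact ((nonneg_iff_isPositive _).1
        (sub_nonneg.2 ((hle _ _).1 (hmono hG)))).inner_nonneg_right x
    have h2 : ⟪(Y - rep θ (p F)) x, x⟫_ℂ = ⟪x, (Y - rep θ (p F)) x⟫_ℂ := by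
      rw [← inner_conj_symm]
      exact Complex.conj_eq_iff_im.2 (Complex.nonneg_iff.1 h1).2.symm
    rw [h2]
    exact ⟨Complex.ext rfl (Complex.nonneg_iff.1 h1).2, (Complex.nonneg_iff.1 h1).1⟩
  have h1 : (1 : H →L[ℂ] H) ≤ Y := by
    have h2 : (1 : K →L[ℂ] K) ≤ θ ⟨Y, hYM⟩ := one_le_of_forall_sum_rankOne_le b fun F => by
      rw [hle, rep_equiv]
      exact hYge F
    rwa [hle, map_one, rep_equiv] at h2
  have h2 : ⟪z, Y z⟫_ℂ = 0 := by
    refine tendsto_nhds_unique (hY z z) (tendsto_const_nhds.congr fun F => ?_)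
    rw [hp, map_sum, sum_apply, Finset.sum_congr rfl fun i _ => hz i]
    simp
  have h3 := ((nonneg_iff_isPositive _).1 (sub_nonneg.2 h1)).inner_nonneg_right z
  rw [sub_apply, inner_sub_right, h2, one_apply_eq_self, zero_sub, inner_self_eq_norm_sq_to_K,
    neg_nonneg] at h3
  have h4 : ‖z‖ ^ 2 ≤ 0 := Complex.real_le_real.1 (by simpa using h3)
  exact norm_eq_zero.1 (pow_eq_zero_iff two_ne_zero |>.1 (le_antisymm h4 (sq_nonneg _)))

variable (y : K)

/-- The subspace of vectors fixed by the projection corresponding to the unit vector `y`. -/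
noncomputable def multiplicitySpace : Submodule ℂ H :=
  LinearMap.ker ((1 - rep θ (rankOne ℂ y y) : H →L[ℂ] H) : H →ₗ[ℂ] H)

theorem mem_multiplicitySpace {w : H} :
    w ∈ multiplicitySpace θ y ↔ rep θ (rankOne ℂ y y) w = w := by
  rw [multiplicitySpace, LinearMap.mem_ker, ContinuousLinearMap.coe_coe, sub_apply, sub_eq_zero,
    one_apply_eq_self, eq_comm]

instance : CompleteSpace (multiplicitySpace θ y) :=
  inferInstanceAs (CompleteSpace
    (LinearMap.ker ((1 - rep θ (rankOne ℂ y y) : H →L[ℂ] H) : H →ₗ[ℂ] H)))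

theorem apply_mem_multiplicitySpace {X : H →L[ℂ] H} (hX : X ∈ M.commutant) {w : H}
    (hw : w ∈ multiplicitySpace θ y) : X w ∈ multiplicitySpace θ y := by
  rw [mem_multiplicitySpace] at hw ⊢
  have h1 := VonNeumannAlgebra.mem_commutant_iff.1 hX _ (rep_mem θ (rankOne ℂ y y))
  have h2 := congrArg (fun T : H →L[ℂ] H => T w) h1
  simp only [mul_apply_eq_comp, hw] at h2
  exact h2

/-- The action of the commutant on the multiplicity space. -/
noncomputable def commutantHom :
    M.commutant.toStarSubalgebra →⋆ₐ[ℂ]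
      (multiplicitySpace θ y →L[ℂ] multiplicitySpace θ y) where
  toFun X := ((X : H →L[ℂ] H) ∘L (multiplicitySpace θ y).subtypeL).codRestrict _
    fun w => apply_mem_multiplicitySpace θ y X.2 w.2
  map_one' := rfl
  map_mul' _ _ := rfl
  map_zero' := rfl
  map_add' _ _ := rfl
  commutes' _ := rfl
  map_star' X := by
    refine ContinuousLinearMap.ext fun w => ext_inner_right ℂ fun v => ?_
    rw [ContinuousLinearMap.star_eq_adjoint, adjoint_inner_left]
    exact adjoint_inner_left (X : H →L[ℂ] H) (v : H) (w : H)

theorem coe_commutantHom_apply (X : M.commutant.toStarSubalgebra) (w : multiplicitySpace θ y) :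
    (commutantHom θ y X w : H) = (X : H →L[ℂ] H) w := rfl

variable {y}

theorem intertwiner_rep_self (w : multiplicitySpace θ y) : intertwiner (rep θ) w y y = w := by
  rw [intertwiner_apply]
  exact (mem_multiplicitySpace θ y).1 w.2

/-- The vectors `|u⟩⟨y| w`, `w` in the multiplicity space, are total. -/
theorem eq_of_forall_intertwiner_apply_eq (hy : ‖y‖ = 1) {X Y : H →L[ℂ] H}
    (h : ∀ (w : multiplicitySpace θ y) (u : K),
      X (intertwiner (rep θ) w y u) = Y (intertwiner (rep θ) w y u)) : X = Y := by
  have hyy : ⟪y, y⟫_ℂ = 1 := by rw [inner_self_eq_norm_sq_to_K, hy]; simp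
  obtain ⟨s, b, -⟩ := exists_hilbertBasis ℂ K
  rw [← sub_eq_zero, ← (adjoint (𝕜 := ℂ) (E := H) (F := H)).map_eq_zero_iff]
  ext z
  refine eq_zero_of_forall_rep_rankOne_apply_eq_zero θ b fun i => ?_
  -- Passing through y, the projection onto b_i factors so that only vectors |b_i⟩⟨y|w with w in the
  -- multiplicity space have to be tested.
  have h1 : rankOne ℂ (b i) (b i) = rankOne ℂ (b i) y * rankOne ℂ y (b i) := by
    rw [rankOne_mul_rankOne, hyy, one_smul]
  have h2 : rep θ (rankOne ℂ y (b i)) (adjoint (X - Y) z) = 0 := by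
    refine ext_inner_left ℂ fun x => ?_
    have h3 : rankOne ℂ y (b i) = star (rankOne ℂ (b i) y) := (star_rankOne _ _).symm
    have hw : rep θ (rankOne ℂ y y) x ∈ multiplicitySpace θ y := by
      rw [mem_multiplicitySpace, ← mul_apply_eq_comp, ← map_mul, rankOne_mul_rankOne, hyy,
        one_smul]
    have h4 := h ⟨_, hw⟩ (b i)
    rw [intertwiner_apply] at h4
    simp only [← mul_apply_eq_comp (rep θ _) (rep θ _)] at h4
    rw [← map_mul, rankOne_mul_rankOne, hyy, one_smul] at h4
    rw [h3, ← inner_map_left, adjoint_inner_right, sub_apply, h4, sub_self, inner_zero_left,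
      inner_zero_right]
  rw [h1, map_mul, mul_apply_eq_comp, h2, map_zero]

/-- X commutes with |u⟩⟨y|, so if it kills the multiplicity space it kills the total set of vectors
|u⟩⟨y|w. -/
theorem commutantHom_injective (hy : ‖y‖ = 1) : Function.Injective (commutantHom θ y) := by
  rw [injective_iff_map_eq_zero]
  intro X hX
  refine Subtype.ext (eq_of_forall_intertwiner_apply_eq θ hy fun w u => ?_)
  have h1 : (X : H →L[ℂ] H) w = 0 := by
    rw [← coe_commutantHom_apply, hX]
    rfl
  have h2 := VonNeumannAlgebra.mem_commutant_iff.1 X.2 _ (rep_mem θ (rankOne ℂ u y))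
  have h3 := congrArg (fun T : H →L[ℂ] H => T w) h2
  simp only [mul_apply_eq_comp] at h3
  rw [intertwiner_apply, ← h3, h1, map_zero]
  rfl

/-- Block diagonal operators built from copies of one operator. -/
theorem norm_sum_conj_le {L ι : Type*} [NormedAddCommGroup L] [InnerProductSpace ℂ L]
    [CompleteSpace L] [DecidableEq ι] {V : ι → L →L[ℂ] H}
    (hV : ∀ i j v w, ⟪V i v, V j w⟫_ℂ = if i = j then ⟪v, w⟫_ℂ else 0)
    (T : L →L[ℂ] L) (F : Finset ι) : ‖∑ i ∈ F, V i ∘L T ∘L adjoint (V i)‖ ≤ ‖T‖ := by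
  have hVV : ∀ i j w, adjoint (V i) (V j w) = if i = j then w else 0 := by
    intro i j w
    refine ext_inner_left ℂ fun v => ?_
    rw [adjoint_inner_right, hV]
    split_ifs <;> simp
  -- The V_i are isometries with orthogonal ranges, so T ↦ ∑ V_i T V_i* is a *-homomorphism and
  -- hence contractive, uniformly in F.
  let Φ : (L →L[ℂ] L) →⋆ₙₐ[ℂ] (H →L[ℂ] H) :=
    { toFun := fun T => ∑ i ∈ F, V i ∘L T ∘L adjoint (V i)
      map_smul' := fun c T => by
        ext z
        simp [sum_apply, Finset.smul_sum]
      map_zero' := by simp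
      map_add' := fun S T => by
        ext z
        simp [sum_apply, Finset.sum_add_distrib]
      map_mul' := fun S T => by
        ext z
        simp only [mul_apply_eq_comp, sum_apply, coe_comp, Function.comp_apply, map_sum, hVV]
        refine Finset.sum_congr rfl fun i hi => ?_
        rw [Finset.sum_eq_single i]
        · simp
        · intro j _ hj
          simp [hj]
        · exact fun h => absurd hi h
      map_star' := fun T => by
        simp only [ContinuousLinearMap.star_eq_adjoint, map_sum, adjoint_comp, adjoint_adjoint,
          comp_assoc] }
  exact NonUnitalStarAlgHom.norm_apply_le Φ T

/-- In the picture H = K ⊗ L, with L the multiplicity space, the preimage of T is 1 ⊗ T. It is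
obtained as a weak limit of the bounded block sums ∑ V_i T V_i* over a basis of K. -/
theorem commutantHom_surjective (hy : ‖y‖ = 1) : Function.Surjective (commutantHom θ y) := by
  classical
  intro T
  obtain ⟨s, b, -⟩ := exists_hilbertBasis ℂ K
  set V : s → multiplicitySpace θ y →L[ℂ] H := fun i =>
    rep θ (rankOne ℂ (b i) y) ∘L (multiplicitySpace θ y).subtypeL with hVdef
  have hVi : ∀ i (w : multiplicitySpace θ y), V i w = intertwiner (rep θ) w y (b i) :=
    fun i w => rfl
  have hV : ∀ i j v w, ⟪V i v, V j w⟫_ℂ = if i = j then ⟪v, w⟫_ℂ else 0 := by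
    intro i j v w
    rw [hVi, hVi, inner_intertwiner, (mem_multiplicitySpace θ y).1 w.2,
      orthonormal_iff_ite.1 b.orthonormal, ite_mul, one_mul, zero_mul]
    rfl
  have hVV : ∀ i j w, adjoint (V i) (V j w) = if i = j then w else 0 := by
    intro i j w
    refine ext_inner_left ℂ fun v => ?_
    rw [adjoint_inner_right, hV]
    split_ifs <;> simp
  let U : Ultrafilter (Finset s) := Ultrafilter.of atTop
  have hU : (U : Filter (Finset s)) ≤ atTop := Ultrafilter.of_le _
  obtain ⟨X, hX⟩ := exists_weak_limit U (X := fun F => ∑ i ∈ F, V i ∘L T ∘L adjoint (V i))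
    fun F => norm_sum_conj_le hV T F
  have h1 : ∀ i w, X (V i w) = V i (T w) := by
    intro i w
    refine ext_inner_left ℂ fun x => tendsto_nhds_unique (hX x (V i w)) ?_
    refine tendsto_const_nhds.congr' ?_
    filter_upwards [hU (eventually_ge_atTop {i})] with F hF
    rw [Finset.singleton_subset_iff] at hF
    rw [sum_apply, Finset.sum_eq_single i]
    · simp [hVV]
    · intro j _ hj
      simp [hVV, hj]
    · exact fun h => absurd hF h
  have h2 : ∀ (w : multiplicitySpace θ y) (u : K),
      X (intertwiner (rep θ) w y u) = intertwiner (rep θ) (T w) y u := by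
    intro w u
    have h3 : X ∘L intertwiner (rep θ) (w : H) y = intertwiner (rep θ) (T w : H) y := by
      refine ContinuousLinearMap.ext_on (s := Set.range b) ?_ ?_
      · exact Submodule.dense_iff_topologicalClosure_eq_top.2 b.dense_span
      · rintro _ ⟨i, rfl⟩
        exact h1 i w
    exact congrArg (fun Z : K →L[ℂ] H => Z u) h3
  have hXM : X ∈ M.commutant := by
    rw [VonNeumannAlgebra.mem_commutant_iff]
    intro Z hZ
    refine eq_of_forall_intertwiner_apply_eq θ hy fun w u => ?_
    have h3 : Z = rep θ (θ ⟨Z, hZ⟩) := (rep_equiv θ ⟨Z, hZ⟩).symm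
    rw [mul_apply_eq_comp, mul_apply_eq_comp, h2, h3, map_apply_intertwiner,
      map_apply_intertwiner, h2]
  refine ⟨⟨X, hXM⟩, ContinuousLinearMap.ext fun w => Subtype.ext ?_⟩
  have h3 := h2 w y
  rw [intertwiner_rep_self, intertwiner_rep_self] at h3
  exact h3

/-- The commutant of a type I factor is a type I factor. -/
theorem IsTypeIFactor.commutant [Nontrivial H] (hM : IsTypeIFactor M) :
    IsTypeIFactor M.commutant := by
  obtain ⟨K, _, _, _, ⟨θ⟩⟩ := hM
  have : Nontrivial K := by
    by_contra hK
    rw [not_nontrivial_iff_subsingleton] at hK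
    have h1 : (1 : H →L[ℂ] H) = 0 := by
      rw [← map_one (rep θ), ← map_zero (rep θ)]
      exact congrArg _ (Subsingleton.elim _ _)
    exact one_ne_zero h1
  obtain ⟨y, hy⟩ := exists_norm_eq K zero_le_one
  exact ⟨multiplicitySpace θ y, inferInstance, inferInstance, inferInstance,
    ⟨StarAlgEquiv.ofBijective (commutantHom θ y)
      ⟨commutantHom_injective θ hy, commutantHom_surjective θ hy⟩⟩⟩

end Commutant

end Arveson

/-- If the past and future states of an interaction have different eigenvalue lists, then the
interaction is nontrivial. -/
theorem corollary1 {H : Type u} [NormedAddCommGroup H] [InnerProductSpace ℂ H] [CompleteSpace H]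
    (I : Arveson.Interaction H)
    (hΛ : Arveson.State.eigenvalueList I.M I.ωm ≠
      Arveson.State.eigenvalueList I.M.commutant I.ωp) :
    ¬ I.IsTrivial := by
  intro hI
  have : Nontrivial H := by
    by_contra h
    rw [not_nontrivial_iff_subsingleton] at h
    exact I.infinite_dimensional inferInstance
  have h₁ := I.ωm_normal.exists_hasEigenvalueList I.typeI
  have h₂ := I.ωp_normal.exists_hasEigenvalueList I.typeI.commutant
  -- Both lists exist, so the default value 0 is not taken. The comparison applies to whichever
  -- lists are chosen, so uniqueness is not needed.
  rw [Arveson.State.eigenvalueList, Arveson.State.eigenvalueList, dif_pos h₁, dif_pos h₂] at hΛ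
  obtain ⟨K₁, _, _, _, θ₁, e₁, hd₁⟩ := h₁.choose_spec.exists_isDiagonalized
  obtain ⟨K₂, _, _, _, θ₂, e₂, hd₂⟩ := h₂.choose_spec.exists_isDiagonalized
  obtain ⟨_, _, _, _, _, _, -, -, hl₁⟩ := h₁.choose_spec
  obtain ⟨_, _, _, _, _, _, -, -, hl₂⟩ := h₂.choose_spec
  exact hΛ (I.eigenvalues_eq_of_isTrivial hI hd₁ hd₂ hl₁.antitone hl₁.nonneg hl₂.antitone
    hl₂.nonneg)
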